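/- Let $n\ge 0$, $1<p<\infty$, let $K\subset\mathbb{R}^n$ be compact and, if $p<2$, suppose moreover that the boundary $\partial K$ has Lebesgue measure zero. Write $\hat f(\xi)=\int_{\mathbb{R}^n}e^{-ix\cdot\xi}f(x)\,dx$ (in the sense of tempered distributions where necessary) and let $E^p_K$ be the space of all $f\in L^p(\mathbb{R}^n)$ such that $\hat f$ is supported by $K$; every such $f$ is identified with its continuous representative. Suppose that $\Lambda\subset\mathbb{R}^n$ is a complete interpolating sequence for $E^p_K$, i.e. for every $v=(v_\lambda)_{\lambda\in\Lambda}\in\ell^p(\Lambda)$ there is a unique $f\in E^p_K$ with $f(\lambda)=v_\lambda$ for all $\lambda\in\Lambda$. Then the indicator function $\chi_K$ is a bounded multiplier of $\mathcal{F}L^p$: there is a bounded linear operator $T$ on $L^p(\mathbb{R}^n)$ such that for all $f\in L^2(\mathbb{R}^n)\cap L^p(\mathbb{R}^n)$ one has $Tf\in L^2(\mathbb{R}^n)$ and $\widehat{Tf}=\chi_K\hat f$ almost everywhere. -/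

import Mathlib

open MeasureTheory SchwartzMap TemperedDistribution FourierTransform
open scoped ENNReal

namespace StableSampling

/-- Multiplication by `(2π)⁻¹`, as a linear automorphism of `ℝⁿ`. -/
noncomputable def scaleEquiv (n : ℕ) :
    EuclideanSpace ℝ (Fin n) ≃L[ℝ] EuclideanSpace ℝ (Fin n) :=
  ContinuousLinearEquiv.smulLeft (Units.mk0 ((2 * Real.pi)⁻¹) (by positivity))

/-- The Fourier transform `φ̂(ξ) = ∫ exp(-i x·ξ) φ(x) dx` on the Schwartz space
(Mathlib's `𝓕` has the kernel `exp(-2πi x·ξ)`, so `φ̂(ξ) = 𝓕 φ (ξ / 2π)`);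
see `schwartzFourier_apply`. -/
noncomputable def schwartzFourier (n : ℕ) :
    𝓢(EuclideanSpace ℝ (Fin n), ℂ) →L[ℂ] 𝓢(EuclideanSpace ℝ (Fin n), ℂ) :=
  (compCLMOfContinuousLinearEquiv ℂ (scaleEquiv n)) ∘L
    (fourierCLM ℂ 𝓢(EuclideanSpace ℝ (Fin n), ℂ))

theorem schwartzFourier_apply {n : ℕ} (φ : 𝓢(EuclideanSpace ℝ (Fin n), ℂ))
    (ξ : EuclideanSpace ℝ (Fin n)) :
    schwartzFourier n φ ξ = ∫ x, Complex.exp (-Complex.I * (inner ℝ x ξ : ℝ)) * φ x := by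
  have h : schwartzFourier n φ ξ = 𝓕 (φ : EuclideanSpace ℝ (Fin n) → ℂ)
      ((2 * Real.pi)⁻¹ • ξ) := rfl
  rw [h, Real.fourier_eq']
  refine integral_congr_ae (Filter.Eventually.of_forall fun x => ?_)
  have hpi : (Real.pi : ℂ) ≠ 0 := by exact_mod_cast Real.pi_ne_zero
  simp only [inner_smul_right, smul_eq_mul]
  congr 2
  push_cast
  field_simp

/-- The Fourier transform of a tempered distribution, by duality: `⟨û, φ⟩ = ⟨u, φ̂⟩`. -/
noncomputable def distFourier {n : ℕ} (u : 𝓢'(EuclideanSpace ℝ (Fin n), ℂ)) :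
    𝓢'(EuclideanSpace ℝ (Fin n), ℂ) :=
  PointwiseConvergenceCLM.precomp ℂ (schwartzFourier n) u

theorem distFourier_apply {n : ℕ} (u : 𝓢'(EuclideanSpace ℝ (Fin n), ℂ))
    (φ : 𝓢(EuclideanSpace ℝ (Fin n), ℂ)) : distFourier u φ = u (schwartzFourier n φ) := rfl

/-- The Fourier transform `f̂(ξ) = ∫ exp(-i x·ξ) f(x) dx` on `L²(ℝⁿ)`, defined by Plancherel's
theorem; it is determined up to a null set. -/
noncomputable def l2Fourier {n : ℕ} (f : Lp ℂ 2 (volume : Measure (EuclideanSpace ℝ (Fin n)))) :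
    EuclideanSpace ℝ (Fin n) → ℂ :=
  fun ξ => (𝓕 f : Lp ℂ 2 (volume : Measure (EuclideanSpace ℝ (Fin n)))) ((2 * Real.pi)⁻¹ • ξ)

/-- For a closed set `K`, the space `E^p_K` of all `f ∈ L^p(ℝⁿ)` whose distributional Fourier
transform is supported by `K`, that is, vanishes on every Schwartz function whose support is
contained in the complement of `K`. -/
def bandlimited {n : ℕ} (p : ℝ≥0∞) [Fact (1 ≤ p)] (K : Set (EuclideanSpace ℝ (Fin n))) :
    Set (Lp ℂ p (volume : Measure (EuclideanSpace ℝ (Fin n)))) :=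
  {f | Distribution.IsVanishingOn (distFourier (Lp.toTemperedDistribution f)) Kᶜ}

/-- `Λ` is a complete interpolating sequence for `E^p_K`: for all values `v ∈ ℓ^p(Λ)` there is a
unique `f ∈ E^p_K` with `f(γ) = v(γ)` for all `γ ∈ Λ`. The point values of an element of `E^p_K`
are those of its continuous representative. -/
def IsCompleteInterpolating {n : ℕ} (p : ℝ≥0∞) [Fact (1 ≤ p)]
    (K Λ : Set (EuclideanSpace ℝ (Fin n))) : Prop :=
  ∀ v : lp (fun _ : Λ => ℂ) p,
    ∃! f : Lp ℂ p (volume : Measure (EuclideanSpace ℝ (Fin n))), f ∈ bandlimited p K ∧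
      ∃ g : EuclideanSpace ℝ (Fin n) → ℂ, Continuous g ∧ f =ᵐ[volume] g ∧
        ∀ γ : Λ, g γ = v γ

/-- `m` is a (bounded) multiplier of `𝓕L^p`: there is a bounded operator `T` on `L^p(ℝⁿ)` such
that, for `f` in the dense subspace `L² ∩ L^p`, the function `T f` is in `L²` as well and has
Fourier transform `m f̂`. -/
def IsFourierMultiplier {n : ℕ} (p : ℝ≥0∞) [Fact (1 ≤ p)]
    (m : EuclideanSpace ℝ (Fin n) → ℂ) : Prop :=
  ∃ T : Lp ℂ p (volume : Measure (EuclideanSpace ℝ (Fin n))) →L[ℂ]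
      Lp ℂ p (volume : Measure (EuclideanSpace ℝ (Fin n))),
    ∀ (f : EuclideanSpace ℝ (Fin n) → ℂ) (hp : MemLp f p volume) (h2 : MemLp f 2 volume),
      ∃ hT : MemLp (T (hp.toLp f)) 2 volume,
        l2Fourier (hT.toLp _) =ᵐ[volume] fun ξ => m ξ * l2Fourier (h2.toLp f) ξ

end StableSampling

/-! Solving the interpolation problem is a bounded operation `S : ℓ^p → E^p_K` by the closed graph
theorem, and its boundedness forces `Λ` to be separated. Choose a Schwartz function `ω` equal to one
near `K`, with Fourier transform `k`. Pairing with the translates of `k` reproduces the point values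
of functions in `E^p_K`. It also makes sense on all of `L^p`, where sampling on the separated set
`Λ` is bounded into `ℓ^p`. Hence `P = S ∘ R`, with `R` this sampling operator, is a bounded
projection of `L^p` onto `E^p_K` (`exists_projection`).

Averaging `⟨P τ_x f, τ_x g⟩` over all translations `x` by an invariant mean yields a bounded
translation invariant form `B` on `L^p × L^q`, with `q` the conjugate exponent. It agrees with the
pairing when `f ∈ E^p_K`, and vanishes when `ĝ` is supported off `K` (`exists_invariant_form`).
Invariance lets smooth Fourier multipliers move between the two arguments (`form_fourierInv_mul`).

The crux is the identity `B(𝓕⁻φ, 𝓕ψ) = ∫_K φψ` for Schwartz functions. If `p ≥ 2`, Hausdorff–Young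
puts `𝓕⁻(χ_K φ)` in `L^p`, so `𝓕⁻φ` splits into a part in `E^p_K` and a limit of functions with
spectrum off `K` (`form_eq_setIntegral_of_two_le_left`). If `p < 2`, then `q ≥ 2` and `𝓕ψ` is
approximated in `L^q` by functions whose spectrum avoids `∂K`, which is possible because `∂K` is
null (`form_eq_setIntegral_of_two_le_right`).

The form then coincides on `L² ∩ L^p` with the `L²` operator `𝓕⁻ χ_K 𝓕`, and the converse of
Hölder's inequality turns boundedness of `B` into `L^p` boundedness of that operator
(`exists_multiplier`). The argument uses Mathlib's Fourier kernel; `K` is therefore replaced by its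
image under `scaleEquiv`. -/

namespace StableSampling

/-! ### Translations on `L^r` and the pairing of `L^p` with `L^q`. -/

section Translation

variable {E : Type*} [NormedAddCommGroup E] [InnerProductSpace ℝ E] [FiniteDimensional ℝ E]
  [MeasurableSpace E] [BorelSpace E]

/-- Translation `f ↦ f (· - x)` on `L^r`. -/
noncomputable def translate (r : ℝ≥0∞) [Fact (1 ≤ r)] (x : E) :
    Lp ℂ r (volume : Measure E) →ₗᵢ[ℂ] Lp ℂ r (volume : Measure E) :=
  Lp.compMeasurePreservingₗᵢ ℂ (fun y => y - x) (measurePreserving_sub_right volume x)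

theorem coeFn_translate (r : ℝ≥0∞) [Fact (1 ≤ r)] (x : E) (f : Lp ℂ r (volume : Measure E)) :
    translate r x f =ᵐ[volume] fun y => f (y - x) :=
  Lp.coeFn_compMeasurePreserving f (measurePreserving_sub_right volume x)

theorem ae_comp_sub {P : E → Prop} (h : ∀ᵐ y, P y) (x : E) : ∀ᵐ y, P (y - x) :=
  (measurePreserving_sub_right volume x).quasiMeasurePreserving.ae h

theorem translate_translate (r : ℝ≥0∞) [Fact (1 ≤ r)] (x y : E)
    (f : Lp ℂ r (volume : Measure E)) :
    translate r x (translate r y f) = translate r (x + y) f := by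
  apply Lp.ext
  filter_upwards [coeFn_translate r x (translate r y f), coeFn_translate r (x + y) f,
    ae_comp_sub (coeFn_translate r y f) x] with z h1 h2 h3
  rw [h1, h2, h3, sub_sub]

theorem translate_zero (r : ℝ≥0∞) [Fact (1 ≤ r)] (f : Lp ℂ r (volume : Measure E)) :
    translate r 0 f = f := by
  apply Lp.ext
  filter_upwards [coeFn_translate r 0 f] with z h1
  rw [h1, sub_zero]

theorem continuous_translate {r : ℝ≥0∞} [Fact (1 ≤ r)] (hr : r ≠ ∞)
    (f : Lp ℂ r (volume : Measure E)) : Continuous fun x => translate r x f := by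
  have hc : Continuous fun x : E => (⟨fun y => y - x, by fun_prop⟩ : C(E, E)) :=
    ContinuousMap.continuous_of_continuous_uncurry _
      (by simp only [Function.uncurry_def, ContinuousMap.coe_mk]; fun_prop)
  exact Continuous.compMeasurePreservingLp (f := fun _ : E => f) continuous_const hc
    (fun x => measurePreserving_sub_right volume x) hr

theorem translate_toLp (r : ℝ≥0∞) [Fact (1 ≤ r)] (x : E) (φ : 𝓢(E, ℂ)) :
    translate r x (φ.toLp r volume) = (compSubConstCLM ℂ x φ).toLp r volume := by
  apply Lp.ext
  filter_upwards [coeFn_translate r x (φ.toLp r volume), (compSubConstCLM ℂ x φ).coeFn_toLp r volume,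
    ae_comp_sub (φ.coeFn_toLp r volume) x] with z h1 h2 h3
  rw [h1, h2, h3, compSubConstCLM_apply]

variable (p q : ℝ≥0∞) [Fact (1 ≤ p)] [Fact (1 ≤ q)] [ENNReal.HolderConjugate p q]

/-- The bilinear pairing `∫ f g` between `L^p` and `L^q`. -/
noncomputable def pair : Lp ℂ p (volume : Measure E) →L[ℂ] Lp ℂ q (volume : Measure E) →L[ℂ] ℂ :=
  (ContinuousLinearMap.mul ℂ ℂ).lpPairing volume p q

variable {p q}

theorem pair_eq_integral (f : Lp ℂ p (volume : Measure E)) (g : Lp ℂ q (volume : Measure E)) :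
    pair p q f g = ∫ x, f x * g x := by
  simp [pair, ContinuousLinearMap.lpPairing_eq_integral]

theorem pair_toLp_right (f : Lp ℂ p (volume : Measure E)) (φ : 𝓢(E, ℂ)) :
    pair p q f (φ.toLp q volume) = ∫ x, f x * φ x := by
  rw [pair_eq_integral]
  refine integral_congr_ae ?_
  filter_upwards [φ.coeFn_toLp q volume] with x hx
  rw [hx]

theorem pair_toLp_toLp (φ ψ : 𝓢(E, ℂ)) :
    pair p q (φ.toLp p volume) (ψ.toLp q volume) = ∫ x, φ x * ψ x := by
  rw [pair_toLp_right]
  refine integral_congr_ae ?_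
  filter_upwards [φ.coeFn_toLp p volume] with x hx
  rw [hx]

theorem norm_pair_le (f : Lp ℂ p (volume : Measure E)) (g : Lp ℂ q (volume : Measure E)) :
    ‖pair p q f g‖ ≤ ‖f‖ * ‖g‖ := by
  have h : pair p q f g = L1.integralCLM' ℂ
      ((ContinuousLinearMap.mul ℂ ℂ).holder 1 f g) := rfl
  have h1 := (ContinuousLinearMap.mul ℂ ℂ).norm_holder_apply_apply_le (r := 1) f g
  rw [h]
  rw [← L1.integral_eq']
  refine (L1.norm_integral_le _).trans (h1.trans ?_)
  gcongr
  exact mul_le_of_le_one_left (norm_nonneg _) (ContinuousLinearMap.opNorm_mul_le ℂ ℂ)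

theorem pair_translate_translate (x : E) (f : Lp ℂ p (volume : Measure E))
    (g : Lp ℂ q (volume : Measure E)) :
    pair p q (translate p x f) (translate q x g) = pair p q f g := by
  rw [pair_eq_integral, pair_eq_integral,
    ← integral_sub_right_eq_self (fun y => f y * g y) x]
  refine integral_congr_ae ?_
  filter_upwards [coeFn_translate p x f, coeFn_translate q x g] with y h1 h2
  rw [h1, h2]

theorem pair_translate_left (x : E) (f : Lp ℂ p (volume : Measure E))
    (g : Lp ℂ q (volume : Measure E)) :
    pair p q (translate p x f) g = pair p q f (translate q (-x) g) := by
  rw [← pair_translate_translate (-x), translate_translate, neg_add_cancel, translate_zero]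

/-- Elements of `L^p` embed injectively into the tempered distributions. -/
theorem eq_of_pair_toLp_eq {f g : Lp ℂ p (volume : Measure E)}
    (h : ∀ θ : 𝓢(E, ℂ), pair p q f (θ.toLp q volume) = pair p q g (θ.toLp q volume)) : f = g := by
  have hk := Lp.ker_toTemperedDistributionCLM_eq_bot (E := E) (F := ℂ) (μ := volume) (p := p)
  rw [LinearMap.ker_eq_bot'] at hk
  rw [← sub_eq_zero]
  refine hk _ ?_
  ext θ
  have h1 := h θ
  rw [← sub_eq_zero, ← sub_apply, ← map_sub, pair_toLp_right] at h1
  simpa [-map_sub, mul_comm] using h1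

end Translation

/-! ### Products, convolutions and spectral subspaces. -/

section Mul

variable {E : Type*} [NormedAddCommGroup E] [NormedSpace ℝ E]

/-- The pointwise product of two Schwartz functions. -/
noncomputable def schwartzMul (φ ψ : 𝓢(E, ℂ)) : 𝓢(E, ℂ) := SchwartzMap.smulLeftCLM ℂ φ ψ

theorem schwartzMul_apply (φ ψ : 𝓢(E, ℂ)) (x : E) : schwartzMul φ ψ x = φ x * ψ x := by
  rw [schwartzMul, SchwartzMap.smulLeftCLM_apply_apply φ.hasTemperateGrowth, smul_eq_mul]

end Mul

section Convolution

variable {E : Type*} [NormedAddCommGroup E] [InnerProductSpace ℝ E] [FiniteDimensional ℝ E]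
  [MeasurableSpace E] [BorelSpace E]

theorem fourier_compSubConstCLM (x : E) (f : 𝓢(E, ℂ)) (ξ : E) :
    𝓕 (compSubConstCLM ℂ x f) ξ = Real.fourierChar (-inner ℝ x ξ) • 𝓕 f ξ := by
  have h := congrFun (VectorFourier.fourierIntegral_comp_add_right Real.fourierChar
    (volume : Measure E) (innerₗ E) (f : E → ℂ) (-x)) ξ
  simp only [innerₗ_apply_apply, inner_neg_left] at h
  have hc : (compSubConstCLM ℂ x f : E → ℂ) = f ∘ fun v => v + -x := by
    ext v; simp [sub_eq_add_neg]
  rw [fourier_coe, fourier_coe, hc]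
  exact h

theorem fourierInv_apply_eq_fourier_neg (f : 𝓢(E, ℂ)) (x : E) : 𝓕⁻ f x = 𝓕 f (-x) := by
  rw [fourierInv_coe, fourier_coe, Real.fourierInv_eq_fourier_neg]

theorem fourierInv_compSubConstCLM (x : E) (f : 𝓢(E, ℂ)) (ξ : E) :
    𝓕⁻ (compSubConstCLM ℂ x f) ξ = Real.fourierChar (inner ℝ x ξ) • 𝓕⁻ f ξ := by
  rw [fourierInv_apply_eq_fourier_neg, fourierInv_apply_eq_fourier_neg, fourier_compSubConstCLM,
    inner_neg_right, neg_neg]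

theorem integral_fourierInv_mul_fourier (φ ψ : 𝓢(E, ℂ)) :
    ∫ x, 𝓕⁻ φ x * 𝓕 ψ x = ∫ ξ, φ ξ * ψ ξ := by
  rw [integral_fourierInv_mul_eq, fourierInv_fourier_eq]

variable {r p q : ℝ≥0∞} [Fact (1 ≤ r)] [Fact (1 ≤ p)] [Fact (1 ≤ q)]
  [ENNReal.HolderConjugate p q]

/-- Translation is modulation on the Fourier side, so Parseval turns the matrix coefficient into a
Fourier integral in `x`. This makes the convolution formulas below computable. -/
theorem pair_translate_fourierInv_fourier (φ ψ : 𝓢(E, ℂ)) (x : E) :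
    pair p q (translate p x ((𝓕⁻ φ : 𝓢(E, ℂ)).toLp p volume)) ((𝓕 ψ : 𝓢(E, ℂ)).toLp q volume) = 𝓕 (schwartzMul φ ψ) x := by
  rw [translate_toLp, pair_toLp_toLp, ← integral_fourier_mul_eq, fourier_coe (schwartzMul φ ψ),
    Real.fourier_eq]
  refine integral_congr_ae (Filter.Eventually.of_forall fun ξ => ?_)
  simp only [fourier_compSubConstCLM, fourier_fourierInv_eq, schwartzMul_apply,
    real_inner_comm x ξ, smul_mul_assoc]

theorem pair_fourierInv_translate_fourier (φ ψ : 𝓢(E, ℂ)) (x : E) :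
    pair p q ((𝓕⁻ φ : 𝓢(E, ℂ)).toLp p volume) (translate q x ((𝓕 ψ : 𝓢(E, ℂ)).toLp q volume)) = 𝓕⁻ (schwartzMul φ ψ) x := by
  have h := pair_translate_left (p := p) (q := q) (-x) ((𝓕⁻ φ : 𝓢(E, ℂ)).toLp p volume) ((𝓕 ψ : 𝓢(E, ℂ)).toLp q volume)
  rw [neg_neg] at h
  rw [← h, pair_translate_fourierInv_fourier, fourierInv_apply_eq_fourier_neg]

/-- Convolution of an element of `L^r` with a function `a`, as a Bochner integral. -/
noncomputable def conv (r : ℝ≥0∞) [Fact (1 ≤ r)] (a : E → ℂ) (f : Lp ℂ r (volume : Measure E)) :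
    Lp ℂ r (volume : Measure E) :=
  ∫ x, a x • translate r x f

theorem integrable_smul_translate (hr : r ≠ ∞) {a : E → ℂ} (ha : Integrable a)
    (f : Lp ℂ r (volume : Measure E)) : Integrable fun x => a x • translate r x f := by
  refine ha.smul_bdd ‖f‖ (continuous_translate hr f).aestronglyMeasurable ?_
  exact Filter.Eventually.of_forall fun x => ((translate r x).norm_map f).le

theorem map_conv {F : Type*} [NormedAddCommGroup F] [NormedSpace ℂ F] [CompleteSpace F]
    (hr : r ≠ ∞) {a : E → ℂ} (ha : Integrable a)
    (f : Lp ℂ r (volume : Measure E)) (L : Lp ℂ r (volume : Measure E) →L[ℂ] F) :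
    L (conv r a f) = ∫ x, a x • L (translate r x f) := by
  rw [conv, ← L.integral_comp_comm (integrable_smul_translate hr ha f)]
  simp only [map_smul]

theorem eq_of_toLp_pair_eq {f g : Lp ℂ q (volume : Measure E)}
    (h : ∀ θ : 𝓢(E, ℂ), pair p q (θ.toLp p volume) f = pair p q (θ.toLp p volume) g) : f = g := by
  have : ENNReal.HolderConjugate q p := ENNReal.HolderConjugate.symm
  have hc : ∀ (a : Lp ℂ p (volume : Measure E)) b, pair q p b a = pair p q a b := fun a b => by
    simp only [pair_eq_integral, mul_comm]
  refine eq_of_pair_toLp_eq (p := q) (q := p) fun θ => ?_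
  rw [hc, hc, h]

theorem conv_fourierInv (hp : p ≠ ∞) (φ ω : 𝓢(E, ℂ)) :
    conv p (𝓕⁻ ω : 𝓢(E, ℂ)) ((𝓕⁻ φ : 𝓢(E, ℂ)).toLp p volume) = (𝓕⁻ (schwartzMul ω φ) : 𝓢(E, ℂ)).toLp p volume := by
  -- Only `p` occurs in the statement; a conjugate exponent is introduced in order to test against
  -- Schwartz functions.
  have := ENNReal.HolderConjugate.inv_one_sub_inv' (Fact.out : 1 ≤ p)
  have : Fact (1 ≤ (1 - p⁻¹)⁻¹) := by simp [fact_iff]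
  refine eq_of_pair_toLp_eq (q := (1 - p⁻¹)⁻¹) fun θ => ?_
  obtain ⟨ψ, rfl⟩ : ∃ ψ, θ = 𝓕 ψ := ⟨𝓕⁻ θ, (fourier_fourierInv_eq θ).symm⟩
  have h := map_conv hp (𝓕⁻ ω : 𝓢(E, ℂ)).integrable ((𝓕⁻ φ : 𝓢(E, ℂ)).toLp p volume)
    ((pair p (1 - p⁻¹)⁻¹).flip ((𝓕 ψ : 𝓢(E, ℂ)).toLp (1 - p⁻¹)⁻¹ volume))
  simp only [ContinuousLinearMap.flip_apply, pair_translate_fourierInv_fourier, smul_eq_mul] at h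
  rw [h, integral_fourierInv_mul_fourier, pair_toLp_toLp, integral_fourierInv_mul_fourier]
  simp only [schwartzMul_apply, mul_assoc]

theorem conv_fourier (hq : q ≠ ∞) (ψ ω : 𝓢(E, ℂ)) :
    conv q (𝓕 ω : 𝓢(E, ℂ)) ((𝓕 ψ : 𝓢(E, ℂ)).toLp q volume) = (𝓕 (schwartzMul ω ψ) : 𝓢(E, ℂ)).toLp q volume := by
  have := ENNReal.HolderConjugate.inv_one_sub_inv' (Fact.out : 1 ≤ q)
  have : ENNReal.HolderConjugate (1 - q⁻¹)⁻¹ q := ENNReal.HolderConjugate.symm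
  have : Fact (1 ≤ (1 - q⁻¹)⁻¹) := by simp [fact_iff]
  refine eq_of_toLp_pair_eq (p := (1 - q⁻¹)⁻¹) fun θ => ?_
  obtain ⟨φ, rfl⟩ : ∃ φ, θ = 𝓕⁻ φ := ⟨𝓕 θ, (fourierInv_fourier_eq θ).symm⟩
  rw [map_conv hq (𝓕 ω : 𝓢(E, ℂ)).integrable]
  simp only [pair_fourierInv_translate_fourier, smul_eq_mul]
  simp_rw [mul_comm (𝓕 ω _)]
  rw [integral_fourierInv_mul_fourier, pair_toLp_toLp, integral_fourierInv_mul_fourier]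
  simp only [schwartzMul_apply]
  congr 1; ext ξ; ring

variable (p q) in
/-- The functions in `L^p` whose Fourier transform (with kernel `exp (-2πi x·ξ)`) is supported
by the closed set `K`. -/
noncomputable def spectralSubspace (K : Set E) : Submodule ℂ (Lp ℂ p (volume : Measure E)) where
  carrier := {f | ∀ ψ : 𝓢(E, ℂ), tsupport ψ ⊆ Kᶜ → pair p q f ((𝓕 ψ : 𝓢(E, ℂ)).toLp q volume) = 0}
  add_mem' hf hg ψ hψ := by rw [map_add, add_apply, hf ψ hψ, hg ψ hψ, add_zero]
  zero_mem' ψ _ := by rw [map_zero, zero_apply]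
  smul_mem' c f hf ψ hψ := by rw [map_smul, smul_apply, hf ψ hψ, smul_zero]

theorem mem_spectralSubspace {K : Set E} {f : Lp ℂ p (volume : Measure E)} :
    f ∈ spectralSubspace p q K ↔
      ∀ ψ : 𝓢(E, ℂ), tsupport ψ ⊆ Kᶜ → pair p q f ((𝓕 ψ : 𝓢(E, ℂ)).toLp q volume) = 0 := Iff.rfl

theorem isClosed_spectralSubspace (K : Set E) :
    IsClosed (spectralSubspace p q K : Set (Lp ℂ p (volume : Measure E))) := by
  have : (spectralSubspace p q K : Set (Lp ℂ p (volume : Measure E))) =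
      ⋂ (ψ : 𝓢(E, ℂ)) (_ : tsupport ψ ⊆ Kᶜ), {f | pair p q f ((𝓕 ψ : 𝓢(E, ℂ)).toLp q volume) = 0} := by
    ext f; simp [mem_spectralSubspace]
  rw [this]
  refine isClosed_iInter fun ψ => isClosed_iInter fun _ => ?_
  exact isClosed_eq ((pair p q).flip ((𝓕 ψ : 𝓢(E, ℂ)).toLp q volume)).continuous continuous_const

/-- Translating the test function `𝓕 ψ` multiplies `ψ` by a character, which does not enlarge its
support. -/
theorem translate_mem_spectralSubspace {K : Set E} {f : Lp ℂ p (volume : Measure E)}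
    (hf : f ∈ spectralSubspace p q K) (x : E) : translate p x f ∈ spectralSubspace p q K := by
  intro ψ hψ
  rw [pair_translate_left, translate_toLp,
    ← fourier_fourierInv_eq (F := 𝓢(E, ℂ)) (compSubConstCLM ℂ (-x) (𝓕 ψ))]
  refine hf _ (subset_trans (closure_mono fun ξ hξ => ?_) hψ)
  rw [Function.mem_support, fourierInv_compSubConstCLM, fourierInv_fourier_eq] at hξ
  intro h0
  exact hξ (by rw [h0, smul_zero])

theorem fourierInv_mem_spectralSubspace {K : Set E} {φ : 𝓢(E, ℂ)} (hφ : Function.support φ ⊆ K) :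
    ((𝓕⁻ φ : 𝓢(E, ℂ)).toLp p volume : Lp ℂ p (volume : Measure E)) ∈ spectralSubspace p q K := by
  intro ψ hψ
  rw [pair_toLp_toLp, integral_fourierInv_mul_fourier]
  refine integral_eq_zero_of_ae (Filter.Eventually.of_forall fun ξ => ?_)
  by_cases h : φ ξ = 0
  · simp [h]
  · have : ψ ξ = 0 := by
      by_contra h'
      exact hψ (subset_tsupport _ h') (hφ h)
    simp [this]

/-- The continuous representative of a function whose spectrum lies in a set near which `ω`
equals one. -/
theorem ae_eq_pair_translate (hq : q ≠ ∞) {K : Set E} {ω : 𝓢(E, ℂ)}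
    (hω : tsupport (fun x => 1 - ω x) ⊆ Kᶜ) {f : Lp ℂ p (volume : Measure E)}
    (hf : f ∈ spectralSubspace p q K) :
    f =ᵐ[volume] fun x => pair p q f (translate q x ((𝓕 ω : 𝓢(E, ℂ)).toLp q volume)) := by
  have hc : Continuous fun x => pair p q f (translate q x ((𝓕 ω : 𝓢(E, ℂ)).toLp q volume)) :=
    (pair p q f).continuous.comp (continuous_translate hq _)
  refine ae_eq_of_integral_contDiff_smul_eq ((Lp.memLp f).locallyIntegrable Fact.out)
    hc.locallyIntegrable fun g hg hgs => ?_
  have hs : HasCompactSupport (Complex.ofRealCLM ∘ g) := hgs.comp_left rfl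
  have hd : ContDiff ℝ (⊤ : ℕ∞) (Complex.ofRealCLM ∘ g) := by fun_prop
  set θ := hs.toSchwartzMap hd with hθ
  have hθg : ∀ x, θ x = (g x : ℂ) := fun x => rfl
  -- With `θ = 𝓕 ψ`, convolution by `𝓕 ω` replaces `ψ` by `ψω`. The difference `ψ(1 - ω)` has
  -- support off `K`, so `f` annihilates its transform.
  have key : pair p q f (θ.toLp q volume) = pair p q f (conv q θ ((𝓕 ω : 𝓢(E, ℂ)).toLp q volume)) := by
    obtain ⟨ψ, h⟩ : ∃ ψ, θ = 𝓕 ψ := ⟨𝓕⁻ θ, (fourier_fourierInv_eq θ).symm⟩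
    rw [h, conv_fourier hq, ← sub_eq_zero, ← map_sub]
    have h2 : ((𝓕 ψ : 𝓢(E, ℂ)).toLp q volume) - (𝓕 (schwartzMul ψ ω) : 𝓢(E, ℂ)).toLp q volume =
        (𝓕 (ψ - schwartzMul ψ ω)  : 𝓢(E, ℂ)).toLp q volume := by
      have := map_sub ((toLpCLM ℂ ℂ q (volume : Measure E)) ∘L fourierCLM ℂ 𝓢(E, ℂ)) ψ
        (schwartzMul ψ ω)
      simpa using this.symm
    rw [h2]
    have hsub : Function.support (ψ - schwartzMul ψ ω) ⊆ Function.support fun x => 1 - ω x := by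
      intro ξ hξ h0
      refine hξ ?_
      rw [sub_apply, schwartzMul_apply]
      linear_combination ψ ξ * h0
    exact hf _ (subset_trans (closure_mono hsub) hω)
  rw [pair_toLp_right, map_conv hq θ.integrable] at key
  simp only [hθg, smul_eq_mul] at key
  simpa [mul_comm] using key

end Convolution

/-! ### Sampling on separated sets and the projection onto the spectral subspace. -/

section Decay

variable {E : Type*} [NormedAddCommGroup E] [NormedSpace ℝ E]

theorem exists_norm_le_one_add_norm_rpow (k : 𝓢(E, ℂ)) (N : ℕ) :
    ∃ C : ℝ, 0 ≤ C ∧ ∀ x, ‖k x‖ ≤ C * (1 + ‖x‖) ^ (-(N : ℝ)) := by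
  refine ⟨2 ^ N * (Finset.Iic (N, 0)).sup (fun m => SchwartzMap.seminorm ℝ m.1 m.2) k,
    by positivity, fun x => ?_⟩
  have h := one_add_le_sup_seminorm_apply (𝕜 := ℝ) (m := (N, 0)) (k := N) (n := 0) le_rfl le_rfl k x
  rw [norm_iteratedFDeriv_zero] at h
  rw [Real.rpow_neg (by positivity), Real.rpow_natCast, ← div_eq_mul_inv, le_div_iff₀ (by positivity),
    mul_comm]
  exact h

end Decay

section Sampling

variable {E : Type*} [NormedAddCommGroup E] [InnerProductSpace ℝ E] [FiniteDimensional ℝ E]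
  [MeasurableSpace E] [BorelSpace E]

/-- Each term is dominated by an average of the weight over a small ball around `a`. These balls are
disjoint, so the sum is at most a multiple of the integral over the whole space, which is finite
since `r` exceeds the dimension. -/
theorem exists_sum_one_add_norm_le {δ : ℝ} (hδ : 0 < δ) {r : ℝ}
    (hr : (Module.finrank ℝ E : ℝ) < r) :
    ∃ C : ℝ, 0 ≤ C ∧ ∀ s : Finset E, (∀ a ∈ s, ∀ b ∈ s, a ≠ b → δ ≤ dist a b) →
      ∀ y, ∑ a ∈ s, (1 + ‖y - a‖) ^ (-r) ≤ C := by
  have hr0 : 0 ≤ r := le_trans (by positivity) hr.le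
  -- Radius `δ / 2` makes the balls disjoint; radius at most `1` keeps the weight comparable on each
  -- ball up to the factor `2 ^ r`.
  set ρ := min (δ / 2) 1 with hρ
  have hρ0 : 0 < ρ := by positivity
  set V := (volume : Measure E).real (Metric.ball 0 ρ) with hV
  have hV0 : 0 < V := ENNReal.toReal_pos (Metric.measure_ball_pos volume 0 hρ0).ne'
    measure_ball_lt_top.ne
  have hint : Integrable (fun x : E => (1 + ‖x‖) ^ (-r)) := integrable_one_add_norm hr
  set J := ∫ x : E, (1 + ‖x‖) ^ (-r) with hJ
  have hJ0 : 0 ≤ J := integral_nonneg fun x => by positivity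
  refine ⟨2 ^ r * J / V, by positivity, fun s hs y => ?_⟩
  have hint' : Integrable (fun x : E => (1 + ‖y - x‖) ^ (-r)) := hint.comp_sub_left y
  have h1 : ∀ a ∈ s, V * (1 + ‖y - a‖) ^ (-r) ≤
      2 ^ r * ∫ x in Metric.ball a ρ, (1 + ‖y - x‖) ^ (-r) := by
    intro a _
    have hVa : V = (volume : Measure E).real (Metric.ball a ρ) := by
      simp only [hV, Measure.real, Measure.addHaar_ball_center]
    rw [hVa, ← integral_const_mul, ← smul_eq_mul, ← setIntegral_const]
    refine setIntegral_mono_on (integrableOn_const measure_ball_lt_top.ne)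
      (hint'.integrableOn.const_mul _) measurableSet_ball fun x hx => ?_
    have hxa : ‖a - x‖ < 1 := by
      rw [← dist_eq_norm, dist_comm]
      exact lt_of_lt_of_le hx (min_le_right _ _)
    have h2 : 1 + ‖y - x‖ ≤ 2 * (1 + ‖y - a‖) := by
      have := norm_add_le (y - a) (a - x)
      rw [sub_add_sub_cancel] at this
      linarith [norm_nonneg (y - a)]
    have h3 : (2 * (1 + ‖y - a‖)) ^ (-r) ≤ (1 + ‖y - x‖) ^ (-r) :=
      Real.rpow_le_rpow_of_nonpos (by positivity) h2 (by linarith)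
    rw [Real.mul_rpow (by norm_num) (by positivity), Real.rpow_neg (by norm_num)] at h3
    rwa [inv_mul_le_iff₀ (by positivity)] at h3
  rw [le_div_iff₀ hV0, mul_comm, Finset.mul_sum]
  refine (Finset.sum_le_sum h1).trans ?_
  rw [← Finset.mul_sum]
  refine mul_le_mul_of_nonneg_left ?_ (by positivity)
  rw [← integral_biUnion_finset s (fun _ _ => measurableSet_ball) ?_
    (fun _ _ => hint'.integrableOn), hJ, ← integral_sub_left_eq_self (fun x : E => (1 + ‖x‖) ^ (-r)) volume y]
  · exact setIntegral_le_integral hint' (Filter.Eventually.of_forall fun x => by positivity)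
  · intro a ha b hb hab
    refine Metric.ball_disjoint_ball ?_
    have := hs a ha b hb hab
    have h4 : ρ ≤ δ / 2 := min_le_left _ _
    linarith

theorem exists_sum_enorm_le (k : 𝓢(E, ℂ)) {δ : ℝ} (hδ : 0 < δ) :
    ∃ C : ℝ≥0∞, C ≠ ∞ ∧ ∀ s : Finset E, (∀ a ∈ s, ∀ b ∈ s, a ≠ b → δ ≤ dist a b) →
      ∀ y, ∑ a ∈ s, ‖k (y - a)‖ₑ ≤ C := by
  obtain ⟨C₁, hC₁, h1⟩ := exists_norm_le_one_add_norm_rpow k (Module.finrank ℝ E + 1)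
  obtain ⟨C₂, hC₂, h2⟩ := exists_sum_one_add_norm_le (E := E) hδ
    (r := ((Module.finrank ℝ E + 1 : ℕ) : ℝ)) (by push_cast; linarith)
  refine ⟨ENNReal.ofReal (C₁ * C₂), ENNReal.ofReal_ne_top, fun s hs y => ?_⟩
  simp only [← ofReal_norm]
  rw [← ENNReal.ofReal_sum_of_nonneg fun _ _ => norm_nonneg _]
  refine ENNReal.ofReal_le_ofReal ?_
  refine (Finset.sum_le_sum fun a _ => h1 (y - a)).trans ?_
  rw [← Finset.mul_sum]
  exact mul_le_mul_of_nonneg_left (h2 s hs y) hC₁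

/-- Weighted Hölder inequality. -/
theorem rpow_lintegral_mul_le {α : Type*} [MeasurableSpace α] {μ : Measure α} {s t : ℝ}
    (hst : s.HolderConjugate t) {f w : α → ℝ≥0∞} (hf : AEMeasurable f μ) (hw : AEMeasurable w μ) :
    (∫⁻ x, f x * w x ∂μ) ^ s ≤ (∫⁻ x, f x ^ s * w x ∂μ) * (∫⁻ x, w x ∂μ) ^ (s / t) := by
  have hs := hst.pos
  have ht := hst.symm.pos
  have h := ENNReal.lintegral_mul_le_Lp_mul_Lq μ hst (f := fun x => f x * w x ^ (1 / s))
    (g := fun x => w x ^ (1 / t)) (hf.mul (hw.pow_const _)) (hw.pow_const _)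
  have e1 : ∀ x, ((fun x => f x * w x ^ (1 / s)) * fun x => w x ^ (1 / t)) x = f x * w x := by
    intro x
    simp only [Pi.mul_apply]
    rw [mul_assoc, ← ENNReal.rpow_add_of_nonneg _ _ (by positivity) (by positivity), one_div, one_div,
      hst.inv_add_inv_eq_one, ENNReal.rpow_one]
  have e2 : ∀ x, (f x * w x ^ (1 / s)) ^ s = f x ^ s * w x := by
    intro x
    rw [ENNReal.mul_rpow_of_nonneg _ _ hs.le, ← ENNReal.rpow_mul, one_div_mul_cancel hs.ne',
      ENNReal.rpow_one]
  have e3 : ∀ x, (w x ^ (1 / t)) ^ t = w x := by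
    intro x
    rw [← ENNReal.rpow_mul, one_div_mul_cancel ht.ne', ENNReal.rpow_one]
  simp only [e1, e2, e3] at h
  refine (ENNReal.rpow_le_rpow h hs.le).trans_eq ?_
  rw [ENNReal.mul_rpow_of_nonneg _ _ hs.le, ← ENNReal.rpow_mul, ← ENNReal.rpow_mul,
    one_div_mul_cancel hs.ne', ENNReal.rpow_one, one_div_mul_eq_div]

variable {p q : ℝ≥0∞} [Fact (1 ≤ p)] [Fact (1 ≤ q)] [ENNReal.HolderConjugate p q]

theorem enorm_pair_translate_le (f : Lp ℂ p (volume : Measure E)) (k : 𝓢(E, ℂ)) (x : E) :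
    ‖pair p q f (translate q x (k.toLp q volume))‖ₑ ≤ ∫⁻ y, ‖f y‖ₑ * ‖k (y - x)‖ₑ := by
  rw [translate_toLp, pair_toLp_right]
  refine (enorm_integral_le_lintegral_enorm _).trans_eq ?_
  simp only [enorm_mul, compSubConstCLM_apply]

/-- A Schur test: Hölder with weight `|k(y - a)|` bounds each term by an integral of `|f|^p` against
this weight, and separation bounds the sum of the weights over `a` uniformly in `y`. -/
theorem exists_sum_pair_translate_le (hp1 : 1 < p) (hp : p ≠ ∞) (k : 𝓢(E, ℂ)) {δ : ℝ}
    (hδ : 0 < δ) :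
    ∃ C : ℝ≥0∞, C ≠ ∞ ∧ ∀ s : Finset E, (∀ a ∈ s, ∀ b ∈ s, a ≠ b → δ ≤ dist a b) →
      ∀ f : Lp ℂ p (volume : Measure E),
        ∑ a ∈ s, ‖pair p q f (translate q a (k.toLp q volume))‖ₑ ^ p.toReal ≤ C * ‖f‖ₑ ^ p.toReal := by
  obtain ⟨C, hC, h⟩ := exists_sum_enorm_le k hδ
  have hp0 : 1 < p.toReal := by
    rw [← ENNReal.toReal_one]; exact (ENNReal.toReal_lt_toReal ENNReal.one_ne_top hp).2 hp1
  have hst : p.toReal.HolderConjugate p.toReal.conjExponent := Real.HolderConjugate.conjExponent hp0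
  set I := ∫⁻ y, ‖k y‖ₑ with hI
  have hIt : I ≠ ∞ := k.integrable.2.ne
  set t := p.toReal.conjExponent
  have hkm : ∀ a : E, Measurable fun y => ‖k (y - a)‖ₑ := fun a => by
    have : Continuous fun y => k (y - a) := k.continuous.comp (by fun_prop)
    exact this.measurable.enorm
  refine ⟨C * I ^ (p.toReal / t), by
    have := hst.symm.pos; finiteness, fun s hs f => ?_⟩
  have hfm : AEMeasurable (fun y => ‖f y‖ₑ) := (Lp.aestronglyMeasurable f).enorm
  have hterm : ∀ a ∈ s, ‖pair p q f (translate q a (k.toLp q volume))‖ₑ ^ p.toReal ≤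
      (∫⁻ y, ‖f y‖ₑ ^ p.toReal * ‖k (y - a)‖ₑ) * I ^ (p.toReal / t) := by
    intro a _
    have h1 := rpow_lintegral_mul_le (μ := (volume : Measure E)) hst hfm (hkm a).aemeasurable
    rw [lintegral_sub_right_eq_self (fun y => ‖k y‖ₑ) a] at h1
    exact (ENNReal.rpow_le_rpow (enorm_pair_translate_le f k a) (by linarith)).trans h1
  refine (Finset.sum_le_sum hterm).trans ?_
  have hsw : ∑ a ∈ s, ∫⁻ y, ‖f y‖ₑ ^ p.toReal * ‖k (y - a)‖ₑ =
      ∫⁻ y, ∑ a ∈ s, ‖f y‖ₑ ^ p.toReal * ‖k (y - a)‖ₑ :=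
    (lintegral_finsetSum' s fun a _ => (hfm.pow_const p.toReal).mul (hkm a).aemeasurable).symm
  rw [← Finset.sum_mul, hsw]
  have h2 : ∫⁻ y, ∑ a ∈ s, ‖f y‖ₑ ^ p.toReal * ‖k (y - a)‖ₑ ≤ C * ‖f‖ₑ ^ p.toReal := by
    have h3 : ‖f‖ₑ ^ p.toReal = ∫⁻ y, ‖f y‖ₑ ^ p.toReal := by
      rw [Lp.enorm_def, eLpNorm_eq_lintegral_rpow_enorm_toReal (by positivity) hp, ← ENNReal.rpow_mul,
        one_div_mul_cancel (by linarith), ENNReal.rpow_one]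
    rw [h3, ← lintegral_const_mul' _ _ hC]
    refine lintegral_mono fun y => ?_
    simp only [← Finset.mul_sum]
    rw [mul_comm]
    gcongr
    exact h s hs y
  calc _ ≤ C * ‖f‖ₑ ^ p.toReal * I ^ (p.toReal / t) := by gcongr
    _ = _ := by ring

theorem exists_sum_norm_pair_translate_le (hp1 : 1 < p) (hp : p ≠ ∞) (k : 𝓢(E, ℂ)) {δ : ℝ}
    (hδ : 0 < δ) {Λ : Set E} (hΛ : ∀ a ∈ Λ, ∀ b ∈ Λ, a ≠ b → δ ≤ dist a b) :
    ∃ D : ℝ, 0 ≤ D ∧ ∀ (f : Lp ℂ p (volume : Measure E)) (s : Finset Λ),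
      ∑ γ ∈ s, ‖pair p q f (translate q (γ : E) (k.toLp q volume))‖ ^ p.toReal ≤
        (D * ‖f‖) ^ p.toReal := by
  obtain ⟨C, hC, h⟩ := exists_sum_pair_translate_le (E := E) (q := q) hp1 hp k hδ
  have hp0 : 0 < p.toReal := ENNReal.toReal_pos (zero_lt_one.trans hp1).ne' hp
  set D : ℝ := (C ^ (1 / p.toReal)).toReal with hD
  have hDp : ENNReal.ofReal D ^ p.toReal = C := by
    rw [hD, ENNReal.ofReal_toReal (by finiteness), ← ENNReal.rpow_mul,
      one_div_mul_cancel hp0.ne', ENNReal.rpow_one]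
  refine ⟨D, ENNReal.toReal_nonneg, fun f s => ?_⟩
  have h1 := h (s.map (Function.Embedding.subtype _)) (by
    simp only [Finset.mem_map, Function.Embedding.subtype_apply]
    rintro _ ⟨a, -, rfl⟩ _ ⟨b, -, rfl⟩ hab
    exact hΛ a a.2 b b.2 hab) f
  rw [Finset.sum_map, ← hDp, ← ENNReal.mul_rpow_of_nonneg _ _ hp0.le] at h1
  simp only [Function.Embedding.subtype_apply, ← ofReal_norm] at h1
  rw [← ENNReal.ofReal_mul ENNReal.toReal_nonneg,
    ENNReal.ofReal_rpow_of_nonneg (by positivity) hp0.le] at h1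
  simp only [ENNReal.ofReal_rpow_of_nonneg (norm_nonneg _) hp0.le] at h1
  rw [← ENNReal.ofReal_sum_of_nonneg fun _ _ => by positivity] at h1
  exact (ENNReal.ofReal_le_ofReal_iff (by positivity)).1 h1

/-- The sampling operator `f ↦ (⟨f, k(· - γ)⟩)_γ` is bounded from `L^p` to `ℓ^p`. -/
theorem exists_sampling (hp1 : 1 < p) (hp : p ≠ ∞) (k : 𝓢(E, ℂ)) {δ : ℝ} (hδ : 0 < δ) {Λ : Set E}
    (hΛ : ∀ a ∈ Λ, ∀ b ∈ Λ, a ≠ b → δ ≤ dist a b) :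
    ∃ R : Lp ℂ p (volume : Measure E) →L[ℂ] lp (fun _ : Λ => ℂ) p,
      ∀ f (γ : Λ), R f γ = pair p q f (translate q (γ : E) (k.toLp q volume)) := by
  obtain ⟨D, hD, hsum⟩ := exists_sum_norm_pair_translate_le (q := q) hp1 hp k hδ hΛ
  have hp0 : 0 < p.toReal := ENNReal.toReal_pos (zero_lt_one.trans hp1).ne' hp
  have hmem : ∀ f : Lp ℂ p (volume : Measure E), ∃ v : lp (fun _ : Λ => ℂ) p,
      ∀ γ : Λ, v γ = pair p q f (translate q (γ : E) (k.toLp q volume)) :=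
    fun f => ⟨⟨_, memℓp_gen' (hsum f)⟩, fun γ => rfl⟩
  choose R hR using hmem
  let L : Lp ℂ p (volume : Measure E) →ₗ[ℂ] lp (fun _ : Λ => ℂ) p :=
    { toFun := R
      map_add' := fun f g => by
        ext γ
        rw [lp.coeFn_add, Pi.add_apply, hR, hR, hR, map_add, add_apply]
      map_smul' := fun c f => by
        ext γ
        rw [lp.coeFn_smul, Pi.smul_apply, hR, hR, map_smul, smul_apply, RingHom.id_apply] }
  refine ⟨L.mkContinuous D fun f => lp.norm_le_of_forall_sum_le hp0
    (mul_nonneg hD (norm_nonneg f)) fun s => ?_, hR⟩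
  refine (Finset.sum_congr rfl fun γ _ => ?_).trans_le (hsum f s)
  rw [← hR]
  rfl

/-- Solving the interpolation problem is a bounded operation. -/
theorem exists_interpolation (κ : Lp ℂ q (volume : Measure E)) {K Λ : Set E}
    (H : ∀ v : lp (fun _ : Λ => ℂ) p, ∃! f, f ∈ spectralSubspace p q K ∧
      ∀ γ : Λ, pair p q f (translate q (γ : E) κ) = v γ) :
    ∃ S : lp (fun _ : Λ => ℂ) p →L[ℂ] Lp ℂ p (volume : Measure E),
      ∀ v, S v ∈ spectralSubspace p q K ∧
        ∀ γ : Λ, pair p q (S v) (translate q (γ : E) κ) = v γ := by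
  choose S hS hu using H
  let L : lp (fun _ : Λ => ℂ) p →ₗ[ℂ] Lp ℂ p (volume : Measure E) :=
    { toFun := S
      map_add' := fun v w => (hu (v + w) (S v + S w) ⟨add_mem (hS v).1 (hS w).1, fun γ => by
        rw [map_add, add_apply, (hS v).2, (hS w).2]; rfl⟩).symm
      map_smul' := fun c v => (hu (c • v) (c • S v) ⟨Submodule.smul_mem _ c (hS v).1, fun γ => by
        rw [map_smul, smul_apply, (hS v).2]; rfl⟩).symm }
  -- Closed graph theorem: the spectral subspace is closed and sampling is continuous, so a limit of
  -- solutions solves the limit problem, and uniqueness identifies it.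
  have hL : Continuous L := by
    refine LinearMap.continuous_of_seq_closed_graph L fun u v f hu' hf => ?_
    refine hu v f ⟨(isClosed_spectralSubspace K).mem_of_tendsto hf
      (Filter.Eventually.of_forall fun n => (hS (u n)).1), fun γ => ?_⟩
    have h1 : Filter.Tendsto (fun n => pair p q (L (u n)) (translate q (γ : E) κ)) Filter.atTop
        (nhds (pair p q f (translate q (γ : E) κ))) :=
      (((pair p q).flip (translate q (γ : E) κ)).continuous.tendsto f).comp hf
    have h2 : Filter.Tendsto (fun n => u n γ) Filter.atTop (nhds (v γ)) :=
      ((lp.evalCLM ℂ (fun _ : Λ => ℂ) p γ).continuous.tendsto v).comp hu'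
    exact tendsto_nhds_unique h1 (h2.congr fun n => ((hS (u n)).2 γ).symm)
  exact ⟨⟨L, hL⟩, hS⟩

/-- The solution for the unit vector at `a` has norm at most `‖S‖`, yet its samples at `a` and `b`
are `1` and `0`. Since translation is continuous in `L^q`, the points `a` and `b` cannot be too
close. -/
theorem separated_of_interpolation (hp0 : 0 < p) (hq : q ≠ ∞) (κ : Lp ℂ q (volume : Measure E))
    {Λ : Set E} (S : lp (fun _ : Λ => ℂ) p →L[ℂ] Lp ℂ p (volume : Measure E))
    (hS : ∀ v, ∀ γ : Λ, pair p q (S v) (translate q (γ : E) κ) = v γ) :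
    ∃ δ : ℝ, 0 < δ ∧ ∀ a ∈ Λ, ∀ b ∈ Λ, a ≠ b → δ ≤ dist a b := by
  classical
  have hc := (continuous_translate hq κ).tendsto 0
  rw [translate_zero] at hc
  -- This tolerance makes `‖S‖` times it strictly less than `1`.
  obtain ⟨δ, hδ, h⟩ := Metric.tendsto_nhds_nhds.1 hc (‖S‖ + 1)⁻¹ (by positivity)
  refine ⟨δ, hδ, fun a ha b hb hab => ?_⟩
  by_contra! hlt
  have h1 := h (x := a - b) (by rwa [dist_zero_right, ← dist_eq_norm])
  set e := lp.single (E := fun _ : Λ => ℂ) p ⟨a, ha⟩ (1 : ℂ) with he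
  have hen : ‖e‖ = 1 := by rw [he, lp.norm_single hp0, norm_one]
  have h2 : pair p q (S e) (translate q a κ - translate q b κ) = 1 := by
    have hba : (⟨b, hb⟩ : Λ) ≠ ⟨a, ha⟩ := fun h => hab (Subtype.ext_iff.1 h).symm
    rw [map_sub, hS e ⟨a, ha⟩, hS e ⟨b, hb⟩, he, lp.single_apply_self, lp.single_apply_ne _ _ _ hba,
      sub_zero]
  have h3 : ‖translate q a κ - translate q b κ‖ = dist (translate q (a - b) κ) κ := by
    rw [dist_eq_norm, ← (translate q b).norm_map (translate q (a - b) κ - κ), map_sub,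
      translate_translate, add_sub_cancel]
  have h4 := norm_pair_le (S e) (translate q a κ - translate q b κ)
  rw [h2, norm_one, h3] at h4
  have h5 : ‖S e‖ ≤ ‖S‖ := by simpa [hen] using S.le_opNorm e
  have h6 : ‖S e‖ * dist (translate q (a - b) κ) κ ≤ ‖S‖ * (‖S‖ + 1)⁻¹ := by gcongr
  have h7 : ‖S‖ * (‖S‖ + 1)⁻¹ < 1 := by
    rw [← div_eq_mul_inv, div_lt_one (by positivity)]; linarith
  linarith

/-- A complete interpolating sequence yields a bounded projection of `L^p` onto the subspace. -/
theorem exists_projection (hp1 : 1 < p) (hp : p ≠ ∞) (hq : q ≠ ∞) (k : 𝓢(E, ℂ)) {K Λ : Set E}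
    (H : ∀ v : lp (fun _ : Λ => ℂ) p, ∃! f, f ∈ spectralSubspace p q K ∧
      ∀ γ : Λ, pair p q f (translate q (γ : E) (k.toLp q volume)) = v γ) :
    ∃ P : Lp ℂ p (volume : Measure E) →L[ℂ] Lp ℂ p (volume : Measure E),
      (∀ f, P f ∈ spectralSubspace p q K) ∧ ∀ f ∈ spectralSubspace p q K, P f = f := by
  obtain ⟨S, hS⟩ := exists_interpolation _ H
  obtain ⟨δ, hδ, hsep⟩ := separated_of_interpolation (zero_lt_one.trans hp1) hq _ S
    fun v => (hS v).2
  obtain ⟨R, hR⟩ := exists_sampling (q := q) hp1 hp k hδ hsep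
  -- A function in the subspace solves the interpolation problem for its own samples, so uniqueness
  -- gives `P f = f`.
  refine ⟨S ∘L R, fun f => (hS _).1, fun f hf => ?_⟩
  exact (H (R f)).unique (hS (R f)) ⟨hf, fun γ => (hR f γ).symm⟩

end Sampling

/-! ### An invariant mean, and averaging of bilinear forms over translations. -/

section Averaging

open Filter Topology BoundedContinuousFunction

variable {E : Type*} [NormedAddCommGroup E] [InnerProductSpace ℝ E] [FiniteDimensional ℝ E]
  [MeasurableSpace E] [BorelSpace E]

/-- Both balls lie in the ball of radius `R + ‖y‖` about `0`; each integral is compared with the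
integral over that ball. -/
theorem norm_setIntegral_ball_sub_le (u : E →ᵇ ℂ) (y : E) {R : ℝ} :
    ‖(∫ x in Metric.ball y R, u x) - ∫ x in Metric.ball 0 R, u x‖ ≤
      2 * ‖u‖ * ((volume : Measure E).real (Metric.ball 0 (R + ‖y‖)) -
        (volume : Measure E).real (Metric.ball 0 R)) := by
  have hi : ∀ (z : E) (r : ℝ), IntegrableOn u (Metric.ball z r) := fun z r =>
    Measure.integrableOn_of_bounded measure_ball_lt_top.ne
      u.continuous.aestronglyMeasurable (Eventually.of_forall fun x => u.norm_coe_le_norm x)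
  have key : ∀ z : E, ‖z‖ ≤ ‖y‖ → ‖(∫ x in Metric.ball 0 (R + ‖y‖), u x) -
      ∫ x in Metric.ball z R, u x‖ ≤ ‖u‖ * ((volume : Measure E).real (Metric.ball 0 (R + ‖y‖)) -
        (volume : Measure E).real (Metric.ball 0 R)) := by
    intro z hz
    have hsub : Metric.ball z R ⊆ Metric.ball 0 (R + ‖y‖) :=
      Metric.ball_subset_ball' (by rw [dist_zero_right]; linarith)
    rw [← setIntegral_sdiff measurableSet_ball (hi _ _) hsub]
    refine (norm_setIntegral_le_of_norm_le_const
      ((measure_mono Set.sdiff_subset).trans_lt measure_ball_lt_top)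
      fun x _ => u.norm_coe_le_norm x).trans_eq ?_
    rw [measureReal_sdiff hsub measurableSet_ball measure_ball_lt_top.ne]
    simp only [Measure.real, Measure.addHaar_ball_center volume z]
  have h1 := key y le_rfl
  have h2 := key 0 (by simp)
  have h3 := norm_sub_le ((∫ x in Metric.ball 0 (R + ‖y‖), u x) - ∫ x in Metric.ball 0 R, u x)
    ((∫ x in Metric.ball 0 (R + ‖y‖), u x) - ∫ x in Metric.ball y R, u x)
  rw [sub_sub_sub_cancel_left] at h3
  linarith

/-- An invariant mean on the bounded continuous functions. -/
theorem exists_invariant_mean : ∃ M : (E →ᵇ ℂ) →ₗ[ℂ] ℂ, (∀ u, ‖M u‖ ≤ ‖u‖) ∧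
    (∀ (u : E →ᵇ ℂ) c, (∀ x, u x = c) → M u = c) ∧
      ∀ (u v : E →ᵇ ℂ) (y : E), (∀ x, v x = u (x + y)) → M v = M u := by
  set V : ℝ → ℝ := fun R => (volume : Measure E).real (Metric.ball 0 R) with hV
  have hV0 : ∀ R, 0 < R → 0 < V R := fun R hR =>
    ENNReal.toReal_pos (Metric.measure_ball_pos volume 0 hR).ne' measure_ball_lt_top.ne
  have hVR : ∀ R, 0 < R → V R = R ^ Module.finrank ℝ E * V 1 := fun R hR => by
    simp only [hV, Measure.real, Measure.addHaar_ball_of_pos volume (0 : E) hR, ENNReal.toReal_mul,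
      ENNReal.toReal_ofReal (pow_nonneg hR.le _)]
  set A : ℕ → (E →ᵇ ℂ) → ℂ := fun N u =>
    ((V (N + 1) : ℝ) : ℂ)⁻¹ * ∫ x in Metric.ball 0 ((N : ℝ) + 1), u x with hA
  have hVN : ∀ N : ℕ, 0 < V (N + 1) := fun N => hV0 _ (by positivity)
  have hVN' : ∀ N : ℕ, ((V (N + 1) : ℝ) : ℂ) ≠ 0 := fun N => by exact_mod_cast (hVN N).ne'
  have hi : ∀ (u : E →ᵇ ℂ) (z : E) (r : ℝ), IntegrableOn u (Metric.ball z r) := fun u z r =>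
    Measure.integrableOn_of_bounded measure_ball_lt_top.ne
      u.continuous.aestronglyMeasurable (Eventually.of_forall fun x => u.norm_coe_le_norm x)
  have hAn : ∀ N u, ‖A N u‖ ≤ ‖u‖ := by
    intro N u
    rw [hA, norm_mul, norm_inv, Complex.norm_real, Real.norm_of_nonneg (hVN N).le,
      inv_mul_le_iff₀ (hVN N), mul_comm]
    exact norm_setIntegral_le_of_norm_le_const measure_ball_lt_top fun x _ => u.norm_coe_le_norm x
  -- The averages over balls stay in a compact disc, so they converge along an ultrafilter; the
  -- limit is then automatically linear.
  have hex : ∀ u, ∃ m, Tendsto (fun N => A N u) (hyperfilter ℕ) (𝓝 m) := by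
    intro u
    obtain ⟨m, -, hm⟩ := (isCompact_closedBall (0 : ℂ) ‖u‖).ultrafilter_le_nhds
      ((hyperfilter ℕ).map fun N => A N u) (by
        rw [Ultrafilter.coe_map, le_principal_iff]
        exact mem_map.2 (univ_mem' fun N => by simpa using hAn N u))
    exact ⟨m, hm⟩
  choose M hM using hex
  have hM' : ∀ u m, Tendsto (fun N => A N u) (hyperfilter ℕ) (𝓝 m) → M u = m :=
    fun u m h => tendsto_nhds_unique (hM u) h
  have hle : (hyperfilter ℕ : Filter ℕ) ≤ atTop := by
    rw [← Nat.cofinite_eq_atTop]; exact hyperfilter_le_cofinite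
  let L : (E →ᵇ ℂ) →ₗ[ℂ] ℂ :=
    { toFun := M
      map_add' := fun u v => hM' _ _ <| ((hM u).add (hM v)).congr fun N => by
        simp only [hA, coe_add, Pi.add_apply]
        rw [integral_add (hi u _ _) (hi v _ _), mul_add]
      map_smul' := fun c u => hM' _ _ <| ((hM u).const_mul c).congr fun N => by
        simp only [hA, coe_smul, smul_eq_mul]
        rw [integral_const_mul]; ring }
  refine ⟨L, fun u => ?_, fun u c hu => ?_, fun u v y huv => ?_⟩
  · exact le_of_tendsto (hM u).norm (Eventually.of_forall fun N => hAn N u)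
  · refine hM' u c (tendsto_const_nhds.congr fun N => ?_)
    simp only [hA, hu]
    rw [setIntegral_const, Complex.real_smul, ← mul_assoc, inv_mul_cancel₀ (hVN' N), one_mul]
  · refine hM' v (M u) ?_
    -- Balls form a Følner sequence: the shell gained by a fixed shift has volume negligible
    -- relative to the ball.
    have h0 : Tendsto (fun N => A N v - A N u) atTop (𝓝 0) := by
      have hb : ∀ N : ℕ, ‖A N v - A N u‖ ≤
          2 * ‖u‖ * ((1 + ‖y‖ * ((N : ℝ) + 1)⁻¹) ^ Module.finrank ℝ E - 1) := by
        intro N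
        have hN : (0 : ℝ) < N + 1 := by positivity
        have h1 : ∫ x in Metric.ball 0 ((N : ℝ) + 1), v x =
            ∫ x in Metric.ball y ((N : ℝ) + 1), u x := by
          have := (measurePreserving_add_right (volume : Measure E) y).setIntegral_preimage_emb
            (measurableEmbedding_addRight y) u (Metric.ball y ((N : ℝ) + 1))
          simp only [huv]
          rw [← this]
          congr 2
          ext x
          simp [dist_eq_norm]
        have h2 := norm_setIntegral_ball_sub_le u y (R := (N : ℝ) + 1)
        have h3 : (V ((N : ℝ) + 1 + ‖y‖) - V (N + 1)) = V (N + 1) *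
            ((1 + ‖y‖ * ((N : ℝ) + 1)⁻¹) ^ Module.finrank ℝ E - 1) := by
          have : (N : ℝ) + 1 + ‖y‖ = ((N : ℝ) + 1) * (1 + ‖y‖ * ((N : ℝ) + 1)⁻¹) := by
            field_simp
          rw [hVR _ (by positivity), hVR _ hN, this, mul_pow]
          ring
        rw [hA]
        simp only
        rw [← mul_sub, h1, norm_mul, norm_inv, Complex.norm_real, Real.norm_of_nonneg (hVN N).le,
          inv_mul_le_iff₀ (hVN N)]
        refine h2.trans_eq ?_
        change 2 * ‖u‖ * (V ((N : ℝ) + 1 + ‖y‖) - V (N + 1)) = _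
        rw [h3]; ring
      refine squeeze_zero_norm hb ?_
      have h4 : Tendsto (fun N : ℕ => ((N : ℝ) + 1)⁻¹) atTop (𝓝 0) := by
        simpa using tendsto_one_div_add_atTop_nhds_zero_nat (𝕜 := ℝ)
      have h5 : Continuous fun t : ℝ => 2 * ‖u‖ * ((1 + ‖y‖ * t) ^ Module.finrank ℝ E - 1) := by
        fun_prop
      simpa [Function.comp_def] using (h5.tendsto 0).comp h4
    simpa using (h0.mono_left hle).add (hM u)

variable {p q : ℝ≥0∞} [Fact (1 ≤ p)] [Fact (1 ≤ q)]

/-- By invariance, a translation by `x` of one argument becomes a translation by `-x` of the other;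
this is integrated against `a`. -/
theorem form_conv (hp : p ≠ ∞) (hq : q ≠ ∞)
    {B : Lp ℂ p (volume : Measure E) →L[ℂ] Lp ℂ q (volume : Measure E) →L[ℂ] ℂ}
    (hB : ∀ y f g, B (translate p y f) (translate q y g) = B f g) {a b : E → ℂ}
    (ha : Integrable a) (hb : Integrable b) (hab : ∀ x, a (-x) = b x)
    (f : Lp ℂ p (volume : Measure E)) (g : Lp ℂ q (volume : Measure E)) : B (conv p a f) g = B f (conv q b g) := by
  have h := map_conv hp ha f (B.flip g)
  simp only [ContinuousLinearMap.flip_apply] at h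
  rw [h, map_conv hq hb g (B f), ← integral_neg_eq_self]
  congr 1
  ext x
  rw [hab, ← hB x, translate_translate, add_neg_cancel, translate_zero]

/-- A translation invariant form is symmetric with respect to Fourier multipliers. -/
theorem form_fourierInv_mul (hp : p ≠ ∞) (hq : q ≠ ∞)
    {B : Lp ℂ p (volume : Measure E) →L[ℂ] Lp ℂ q (volume : Measure E) →L[ℂ] ℂ}
    (hB : ∀ y f g, B (translate p y f) (translate q y g) = B f g) (ω φ ψ : 𝓢(E, ℂ)) :
    B ((𝓕⁻ (schwartzMul ω φ) : 𝓢(E, ℂ)).toLp p volume) ((𝓕 ψ : 𝓢(E, ℂ)).toLp q volume) =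
      B ((𝓕⁻ φ : 𝓢(E, ℂ)).toLp p volume) ((𝓕 (schwartzMul ω ψ) : 𝓢(E, ℂ)).toLp q volume) := by
  rw [← conv_fourierInv hp, ← conv_fourier hq]
  refine form_conv hp hq hB (𝓕⁻ ω : 𝓢(E, ℂ)).integrable (𝓕 ω : 𝓢(E, ℂ)).integrable (fun x => ?_) _ _
  rw [fourierInv_apply_eq_fourier_neg, neg_neg]

variable [ENNReal.HolderConjugate p q]

/-- Averaging the bilinear form of an operator over all translations. -/
theorem exists_averaged_form (hp : p ≠ ∞) (hq : q ≠ ∞)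
    (P : Lp ℂ p (volume : Measure E) →L[ℂ] Lp ℂ p (volume : Measure E)) :
    ∃ B : Lp ℂ p (volume : Measure E) →L[ℂ] Lp ℂ q (volume : Measure E) →L[ℂ] ℂ,
      (∀ y f g, B (translate p y f) (translate q y g) = B f g) ∧
      ∀ f g c, (∀ x, pair p q (P (translate p x f)) (translate q x g) = c) → B f g = c := by
  obtain ⟨M, hM1, hM2, hM3⟩ := exists_invariant_mean (E := E)
  -- The bounded continuous function of `x` whose mean defines `B f g`.
  have hex : ∀ (f : Lp ℂ p (volume : Measure E)) (g : Lp ℂ q (volume : Measure E)),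
      ∃ u : E →ᵇ ℂ, (∀ x, u x = pair p q (P (translate p x f)) (translate q x g)) ∧
        ‖u‖ ≤ ‖P‖ * ‖f‖ * ‖g‖ := by
    intro f g
    have hc : Continuous fun x => pair p q (P (translate p x f)) (translate q x g) :=
      ((pair p q).continuous.comp (P.continuous.comp (continuous_translate hp f))).clm_apply
        (continuous_translate hq g)
    have hb : ∀ x, ‖pair p q (P (translate p x f)) (translate q x g)‖ ≤ ‖P‖ * ‖f‖ * ‖g‖ := by
      intro x
      refine (norm_pair_le _ _).trans ?_
      rw [LinearIsometry.norm_map]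
      gcongr
      exact (P.le_opNorm _).trans_eq (by rw [LinearIsometry.norm_map])
    exact ⟨ofNormedAddCommGroup _ hc _ hb, fun x => rfl,
      norm_ofNormedAddCommGroup_le hc (by positivity) hb⟩
  choose u hu hun using hex
  let B : Lp ℂ p (volume : Measure E) →ₗ[ℂ] Lp ℂ q (volume : Measure E) →ₗ[ℂ] ℂ :=
    LinearMap.mk₂ ℂ (fun f g => M (u f g))
      (fun f₁ f₂ g => by rw [← map_add]; congr 1; ext x; simp [hu])
      (fun c f g => by rw [← map_smul]; congr 1; ext x; simp [hu])
      (fun f g₁ g₂ => by rw [← map_add]; congr 1; ext x; simp [hu])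
      (fun c f g => by rw [← map_smul]; congr 1; ext x; simp [hu])
  refine ⟨B.mkContinuous₂ ‖P‖ fun f g => (hM1 _).trans (hun f g), fun y f g => ?_,
    fun f g c h => hM2 _ c fun x => (hu f g x).trans (h x)⟩
  refine hM3 (u f g) (u (translate p y f) (translate q y g)) y fun x => ?_
  rw [hu, hu, translate_translate, translate_translate]

/-- Averaging a projection onto the spectral subspace over all translations. -/
theorem exists_invariant_form (hp : p ≠ ∞) (hq : q ≠ ∞) {K : Set E}
    (P : Lp ℂ p (volume : Measure E) →L[ℂ] Lp ℂ p (volume : Measure E))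
    (hP : ∀ f, P f ∈ spectralSubspace p q K) (hP' : ∀ f ∈ spectralSubspace p q K, P f = f) :
    ∃ B : Lp ℂ p (volume : Measure E) →L[ℂ] Lp ℂ q (volume : Measure E) →L[ℂ] ℂ,
      (∀ y f g, B (translate p y f) (translate q y g) = B f g) ∧
      (∀ f ∈ spectralSubspace p q K, ∀ g, B f g = pair p q f g) ∧
      ∀ f (ψ : 𝓢(E, ℂ)), tsupport ψ ⊆ Kᶜ → B f ((𝓕 ψ : 𝓢(E, ℂ)).toLp q volume) = 0 := by
  obtain ⟨B, hB1, hB2⟩ := exists_averaged_form (q := q) hp hq P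
  refine ⟨B, hB1, fun f hf g => hB2 f g _ fun x => ?_, fun f ψ hψ => hB2 f _ _ fun x => ?_⟩
  -- In both cases the averaged function is constant: here `P` fixes every translate of `f`; below
  -- `P (τ_x f)`, translated back by `-x`, stays in the subspace and annihilates `𝓕 ψ`.
  · rw [hP' _ (translate_mem_spectralSubspace hf x), pair_translate_translate]
  · have h := pair_translate_left (p := p) (q := q) (-x) (P (translate p x f))
      ((𝓕 ψ : 𝓢(E, ℂ)).toLp q volume)
    rw [neg_neg] at h
    rw [← h]
    exact translate_mem_spectralSubspace (hP _) _ ψ hψ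

end Averaging

/-! ### Dominated convergence in `L^r`. -/

section Dominated

open Filter Topology

variable {α : Type*} [MeasurableSpace α] {μ : Measure α}

theorem tendsto_eLpNorm_sub_of_dominated {r : ℝ≥0∞} (hr0 : r ≠ 0) (hr : r ≠ ∞) {f : ℕ → α → ℂ}
    {g G : α → ℂ} (hf : ∀ n, AEStronglyMeasurable (f n) μ) (hG : MemLp G r μ)
    (hb : ∀ n, ∀ᵐ x ∂μ, ‖f n x‖ ≤ ‖G x‖)
    (hlim : ∀ᵐ x ∂μ, Tendsto (fun n => f n x) atTop (𝓝 (g x))) :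
    Tendsto (fun n => eLpNorm (f n - g) r μ) atTop (𝓝 0) := by
  have hr' : 0 < r.toReal := ENNReal.toReal_pos hr0 hr
  have hg : AEStronglyMeasurable g μ := aestronglyMeasurable_of_tendsto_ae _ hf hlim
  have hb' := ae_all_iff.2 hb
  have key : Tendsto (fun n => ∫⁻ x, ‖(f n - g) x‖ₑ ^ r.toReal ∂μ) atTop (𝓝 (∫⁻ _, 0 ∂μ)) := by
    refine tendsto_lintegral_of_dominated_convergence' (fun x => ‖(2 : ℂ) • G x‖ₑ ^ r.toReal)
      (fun n => ((hf n).sub hg).enorm.pow_const _) (fun n => ?_) ?_ ?_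
    · filter_upwards [hb', hlim] with x hx hl
      have h1 : ‖g x‖ ≤ ‖G x‖ := le_of_tendsto hl.norm (Eventually.of_forall hx)
      have h2 : ‖f n x - g x‖ ≤ ‖(2 : ℂ) • G x‖ := by
        rw [norm_smul, Complex.norm_two]
        linarith [norm_sub_le (f n x) (g x), hx n]
      refine ENNReal.rpow_le_rpow ?_ hr'.le
      simpa only [Pi.sub_apply, ← ofReal_norm] using ENNReal.ofReal_le_ofReal h2
    · exact (lintegral_rpow_enorm_lt_top_of_eLpNorm_lt_top hr0 hr (hG.const_smul (2 : ℂ)).2).ne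
    · filter_upwards [hlim] with x hl
      have h1 : Tendsto (fun n => ‖f n x - g x‖ₑ) atTop (𝓝 0) := by
        have := (hl.sub_const (g x)).enorm
        simpa using this
      have := (ENNReal.continuous_rpow_const (y := r.toReal)).tendsto 0 |>.comp h1
      simpa [Function.comp_def, ENNReal.zero_rpow_of_pos hr'] using this
  simp only [eLpNorm_eq_lintegral_rpow_enorm_toReal hr0 hr]
  have := (ENNReal.continuous_rpow_const (y := 1 / r.toReal)).tendsto _ |>.comp key
  simpa [Function.comp_def, ENNReal.zero_rpow_of_pos (inv_pos.2 hr')] using this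

end Dominated

/-! ### Smooth cutoff functions. -/

section Cutoff

open Filter Topology

variable {E : Type*} [NormedAddCommGroup E] [InnerProductSpace ℝ E] [FiniteDimensional ℝ E]

/-- Schwartz cutoff functions exhausting an open set. -/
theorem exists_cutoff_seq {U : Set E} (hU : IsOpen U) : ∃ χ : ℕ → 𝓢(E, ℂ),
    (∀ j, tsupport (χ j) ⊆ U) ∧ (∀ j x, ‖χ j x‖ ≤ 1) ∧
      ∀ x, Tendsto (fun j => χ j x) atTop (𝓝 (U.indicator 1 x)) := by
  obtain ⟨f, hfs, hf, hfr⟩ := hU.exists_contDiff_support_eq (n := ⊤)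
  let b : ℕ → ContDiffBump (0 : E) := fun j => ⟨(j : ℝ) + 1, (j : ℝ) + 2, by positivity, by linarith⟩
  -- The first factor vanishes where `j f ≤ 1` and equals one where `j f ≥ 2`, so the closed support
  -- stays inside `U`; the bump makes it compact.
  let h : ℕ → E → ℝ := fun j x => Real.smoothTransition (j * f x - 1) * b j x
  have hh : ∀ j, ContDiff ℝ (⊤ : ℕ∞) (h j) := fun j =>
    (Real.smoothTransition.contDiff.comp ((contDiff_const.mul hf).sub contDiff_const)).mul
      (b j).contDiff
  have hc : ∀ j, HasCompactSupport (h j) := fun j => (b j).hasCompactSupport.mul_left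
  have hC : ∀ j, ContDiff ℝ (⊤ : ℕ∞) (Complex.ofRealCLM ∘ h j) := fun j =>
    Complex.ofRealCLM.contDiff.comp (hh j)
  have hCc : ∀ j, HasCompactSupport (Complex.ofRealCLM ∘ h j) := fun j => (hc j).comp_left rfl
  refine ⟨fun j => (hCc j).toSchwartzMap (hC j), fun j => ?_, fun j x => ?_, fun x => ?_⟩
  · have h1 : IsClosed {x | 1 ≤ j * f x} :=
      isClosed_le continuous_const (continuous_const.mul hf.continuous)
    refine (closure_minimal (fun x hx => ?_) h1).trans fun x hx => ?_
    · by_contra hlt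
      refine hx ?_
      have : Real.smoothTransition (j * f x - 1) = 0 :=
        Real.smoothTransition.zero_of_nonpos (by simp only [Set.mem_ofPred_eq] at hlt; linarith)
      simp [h, this]
    · rw [← hfs, Function.mem_support]
      rintro h0
      simp only [Set.mem_ofPred_eq, h0, mul_zero] at hx
      linarith
  · change ‖((h j x : ℝ) : ℂ)‖ ≤ 1
    rw [Complex.norm_real, Real.norm_of_nonneg (mul_nonneg (Real.smoothTransition.nonneg _)
      (b j).nonneg)]
    exact mul_le_one₀ (Real.smoothTransition.le_one _) (b j).nonneg (b j).le_one
  · change Tendsto (fun j => ((h j x : ℝ) : ℂ)) atTop _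
    by_cases hx : x ∈ U
    · have hfx : 0 < f x := lt_of_le_of_ne (hfr ⟨x, rfl⟩).1 (Ne.symm (by rwa [← hfs] at hx))
      rw [Set.indicator_of_mem hx]
      refine tendsto_const_nhds.congr' ?_
      have e1 : ∀ᶠ j : ℕ in atTop, 2 / f x ≤ j := tendsto_natCast_atTop_atTop.eventually_ge_atTop _
      have e2 : ∀ᶠ j : ℕ in atTop, ‖x‖ ≤ j := tendsto_natCast_atTop_atTop.eventually_ge_atTop _
      filter_upwards [e1, e2] with j h1 h2
      rw [div_le_iff₀ hfx] at h1
      have h3 : Real.smoothTransition (j * f x - 1) = 1 :=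
        Real.smoothTransition.one_of_one_le (by linarith)
      have h4 : b j x = 1 := (b j).one_of_mem_closedBall (by
        rw [mem_closedBall_zero_iff]; exact h2.trans (by simp [b]))
      simp [h, h3, h4]
    · have hfx : f x = 0 := by
        by_contra h0; exact hx (by rw [← hfs]; exact h0)
      rw [Set.indicator_of_notMem hx]
      refine tendsto_const_nhds.congr fun j => ?_
      have : Real.smoothTransition (j * f x - 1) = 0 :=
        Real.smoothTransition.zero_of_nonpos (by rw [hfx]; linarith)
      simp [h, this]

/-- A Schwartz function which equals one near a bounded set. -/
theorem exists_schwartz_one_near {K : Set E} (hK : Bornology.IsBounded K) :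
    ∃ ω : 𝓢(E, ℂ), tsupport (fun x => 1 - ω x) ⊆ Kᶜ := by
  obtain ⟨R, hR⟩ := hK.subset_closedBall 0
  let b : ContDiffBump (0 : E) := ⟨|R| + 1, |R| + 2, by positivity, by linarith⟩
  have hC : ContDiff ℝ (⊤ : ℕ∞) (Complex.ofRealCLM ∘ b) := Complex.ofRealCLM.contDiff.comp b.contDiff
  have hCc : HasCompactSupport (Complex.ofRealCLM ∘ b) := b.hasCompactSupport.comp_left rfl
  refine ⟨hCc.toSchwartzMap hC, (closure_minimal (t := (Metric.ball 0 (|R| + 1))ᶜ) (fun x hx hxb => ?_)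
    Metric.isOpen_ball.isClosed_compl).trans (Set.compl_subset_compl.2 fun x hx => ?_)⟩
  · refine hx ?_
    have : b x = 1 := b.one_of_mem_closedBall (Metric.ball_subset_closedBall hxb)
    change 1 - ((b x : ℝ) : ℂ) = 0
    rw [this]; simp
  · have h1 := hR hx
    rw [mem_closedBall_zero_iff] at h1
    rw [mem_ball_zero_iff]
    linarith [le_abs_self R]

end Cutoff

/-! ### Hausdorff–Young bounds and convergence of cut-off products. -/

section Convergence

open Filter Topology

variable {E : Type*} [NormedAddCommGroup E] [InnerProductSpace ℝ E] [FiniteDimensional ℝ E]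
  [MeasurableSpace E] [BorelSpace E]

/-- Interpolation between `L²` and `L^∞`: pointwise `|f|^r ≤ c^(r-2) |f|²`. -/
theorem norm_toLp_le_of_bounded {r : ℝ≥0∞} (hr2 : 2 ≤ r) (hr : r ≠ ∞) (f : 𝓢(E, ℂ)) {a c : ℝ}
    (hac : a ≤ c) (h1 : ∀ x, ‖f x‖ ≤ a) (h2 : ‖f.toLp 2 (volume : Measure E)‖ ≤ c) :
    ‖f.toLp r (volume : Measure E)‖ ≤ c := by
  have ht : 2 ≤ r.toReal := by
    rw [← ENNReal.toReal_ofNat 2]; exact (ENNReal.toReal_le_toReal (by simp) hr).2 hr2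
  have hc : 0 ≤ c := (norm_nonneg _).trans h2
  have hr0 : r ≠ 0 := by rintro rfl; simp at hr2
  have e2 : ‖f.toLp 2 (volume : Measure E)‖ₑ ^ (2 : ℝ) = ∫⁻ x, ‖f x‖ₑ ^ (2 : ℝ) := by
    rw [Lp.enorm_def, eLpNorm_congr_ae (f.coeFn_toLp 2 volume),
      eLpNorm_eq_lintegral_rpow_enorm_toReal (by simp) (by simp), ← ENNReal.rpow_mul]
    simp
  have er : ‖f.toLp r (volume : Measure E)‖ₑ ^ r.toReal = ∫⁻ x, ‖f x‖ₑ ^ r.toReal := by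
    rw [Lp.enorm_def, eLpNorm_congr_ae (f.coeFn_toLp r volume),
      eLpNorm_eq_lintegral_rpow_enorm_toReal hr0 hr, ← ENNReal.rpow_mul,
      one_div_mul_cancel (by linarith), ENNReal.rpow_one]
  have hC : ∀ x, ‖f x‖ₑ ≤ ENNReal.ofReal c := fun x => by
    rw [← ofReal_norm]; exact ENNReal.ofReal_le_ofReal ((h1 x).trans hac)
  have key : ‖f.toLp r (volume : Measure E)‖ₑ ^ r.toReal ≤ ENNReal.ofReal c ^ r.toReal := by
    rw [er]
    have hpt : ∀ x, ‖f x‖ₑ ^ r.toReal ≤ ENNReal.ofReal c ^ (r.toReal - 2) * ‖f x‖ₑ ^ (2 : ℝ) := by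
      intro x
      calc ‖f x‖ₑ ^ r.toReal = ‖f x‖ₑ ^ (r.toReal - 2) * ‖f x‖ₑ ^ (2 : ℝ) := by
            rw [← ENNReal.rpow_add_of_nonneg _ _ (by linarith) (by norm_num), sub_add_cancel]
        _ ≤ _ := by gcongr; exact hC x
    refine (lintegral_mono hpt).trans ?_
    rw [lintegral_const_mul' _ _ (by have := sub_nonneg.2 ht; finiteness), ← e2]
    calc _ ≤ ENNReal.ofReal c ^ (r.toReal - 2) * ENNReal.ofReal c ^ (2 : ℝ) := by
          gcongr
          rw [← ofReal_norm]; exact ENNReal.ofReal_le_ofReal h2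
      _ = _ := by rw [← ENNReal.rpow_add_of_nonneg _ _ (by linarith) (by norm_num), sub_add_cancel]
  have h3 := (ENNReal.rpow_le_rpow_iff (by linarith : 0 < r.toReal)).1 key
  rw [Lp.enorm_def] at h3
  rw [Lp.norm_def]
  exact ENNReal.toReal_le_of_le_ofReal hc h3

/-- An elementary Hausdorff–Young inequality. -/
theorem norm_fourier_toLp_le {r : ℝ≥0∞} (hr2 : 2 ≤ r) (hr : r ≠ ∞) (ψ : 𝓢(E, ℂ)) :
    ‖(𝓕 ψ : 𝓢(E, ℂ)).toLp r (volume : Measure E)‖ ≤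
      ‖ψ.toLp 1 (volume : Measure E)‖ + ‖ψ.toLp 2 (volume : Measure E)‖ := by
  refine norm_toLp_le_of_bounded hr2 hr _ (le_add_of_nonneg_right (norm_nonneg _))
    (norm_fourier_apply_le_toLp_one ψ) ?_
  rw [norm_fourier_toL2_eq]
  exact le_add_of_nonneg_left (norm_nonneg _)

theorem norm_fourierInv_toLp_le {r : ℝ≥0∞} (hr2 : 2 ≤ r) (hr : r ≠ ∞) (ψ : 𝓢(E, ℂ)) :
    ‖(𝓕⁻ ψ : 𝓢(E, ℂ)).toLp r (volume : Measure E)‖ ≤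
      ‖ψ.toLp 1 (volume : Measure E)‖ + ‖ψ.toLp 2 (volume : Measure E)‖ := by
  refine norm_toLp_le_of_bounded hr2 hr _ (le_add_of_nonneg_right (norm_nonneg _))
    (fun x => ?_) ?_
  · rw [fourierInv_apply_eq_fourier_neg]
    exact norm_fourier_apply_le_toLp_one ψ _
  · rw [← norm_fourier_toL2_eq (𝓕⁻ ψ : 𝓢(E, ℂ)), fourier_fourierInv_eq]
    exact le_add_of_nonneg_left (norm_nonneg _)

theorem tendsto_schwartzMul_toLp {r : ℝ≥0∞} [Fact (1 ≤ r)] (hr : r ≠ ∞) {ω : ℕ → 𝓢(E, ℂ)} {C : ℝ}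
    (hC : ∀ j x, ‖ω j x‖ ≤ C) {m : E → ℂ}
    (hm : ∀ᵐ x, Tendsto (fun j => ω j x) atTop (𝓝 (m x))) (φ : 𝓢(E, ℂ))
    {g : Lp ℂ r (volume : Measure E)} (hg : g =ᵐ[volume] fun x => m x * φ x) :
    Tendsto (fun j => (schwartzMul (ω j) φ).toLp r (volume : Measure E)) atTop (𝓝 g) := by
  have hr0 : r ≠ 0 := (zero_lt_one.trans_le (Fact.out : 1 ≤ r)).ne'
  rw [Lp.tendsto_Lp_iff_tendsto_eLpNorm']
  have h := tendsto_eLpNorm_sub_of_dominated (μ := volume) hr0 hr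
    (f := fun j => schwartzMul (ω j) φ) (g := fun x => m x * φ x)
    (G := fun x => (C : ℂ) * φ x)
    (fun j => (schwartzMul (ω j) φ).continuous.aestronglyMeasurable)
    ((φ.memLp r volume).const_mul (C : ℂ)) (fun j => Eventually.of_forall fun x => ?_) ?_
  · refine h.congr fun j => eLpNorm_congr_ae ?_
    filter_upwards [hg, (schwartzMul (ω j) φ).coeFn_toLp r volume] with x h1 h2
    simp only [Pi.sub_apply, h1, h2]
  · rw [schwartzMul_apply, norm_mul, norm_mul, Complex.norm_real]
    gcongr
    exact (hC j x).trans (le_abs_self C)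
  · filter_upwards [hm] with x hx
    simp only [schwartzMul_apply]
    exact hx.mul_const _

theorem tendsto_integral_schwartzMul {ω : ℕ → 𝓢(E, ℂ)} {C : ℝ} (hC : ∀ j x, ‖ω j x‖ ≤ C)
    {U : Set E} (hU : MeasurableSet U)
    (hω : ∀ x, Tendsto (fun j => ω j x) atTop (𝓝 (U.indicator 1 x))) (φ ψ : 𝓢(E, ℂ)) :
    Tendsto (fun j => ∫ x, schwartzMul (ω j) φ x * ψ x) atTop (𝓝 (∫ x in U, φ x * ψ x)) := by
  rw [← integral_indicator hU]
  refine tendsto_integral_of_dominated_convergence (fun x => C * ‖schwartzMul φ ψ x‖)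
    (fun j => ((schwartzMul (ω j) φ).continuous.mul ψ.continuous).aestronglyMeasurable)
    ((schwartzMul φ ψ).integrable.norm.const_mul C) (fun j => Eventually.of_forall fun x => ?_)
    (Eventually.of_forall fun x => ?_)
  · rw [schwartzMul_apply, schwartzMul_apply, mul_assoc, norm_mul]
    gcongr
    exact hC j x
  · have h1 : U.indicator (fun x => φ x * ψ x) x = U.indicator 1 x * (φ x * ψ x) := by
      by_cases hx : x ∈ U <;> simp [hx]
    rw [h1]
    simp only [schwartzMul_apply, mul_assoc]
    exact (hω x).mul_const _

end Convergence

section Support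

variable {E : Type*} [NormedAddCommGroup E] [NormedSpace ℝ E]

theorem tsupport_schwartzMul_subset (ω φ : 𝓢(E, ℂ)) :
    tsupport (schwartzMul ω φ) ⊆ tsupport ω :=
  (SchwartzMap.tsupport_smulLeftCLM_subset (F := ℂ) ω φ).trans Set.inter_subset_right

end Support

/-! ### The averaged form is integration over `K` on the Fourier side. -/

section FormIdentity

open Filter Topology

variable {E : Type*} [NormedAddCommGroup E] [InnerProductSpace ℝ E] [FiniteDimensional ℝ E]
  [MeasurableSpace E] [BorelSpace E]

theorem toLp_fourier_sub (r : ℝ≥0∞) [Fact (1 ≤ r)] (φ ψ : 𝓢(E, ℂ)) :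
    (𝓕 (φ - ψ) : 𝓢(E, ℂ)).toLp r (volume : Measure E) =
      (𝓕 φ : 𝓢(E, ℂ)).toLp r volume - (𝓕 ψ : 𝓢(E, ℂ)).toLp r volume :=
  map_sub ((toLpCLM ℂ ℂ r (volume : Measure E)) ∘L fourierCLM ℂ 𝓢(E, ℂ)) φ ψ

theorem toLp_fourierInv_sub (r : ℝ≥0∞) [Fact (1 ≤ r)] (φ ψ : 𝓢(E, ℂ)) :
    (𝓕⁻ (φ - ψ) : 𝓢(E, ℂ)).toLp r (volume : Measure E) =
      (𝓕⁻ φ : 𝓢(E, ℂ)).toLp r volume - (𝓕⁻ ψ : 𝓢(E, ℂ)).toLp r volume :=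
  map_sub ((toLpCLM ℂ ℂ r (volume : Measure E)) ∘L fourierInvCLM ℂ 𝓢(E, ℂ)) φ ψ

theorem toLp_sub (r : ℝ≥0∞) [Fact (1 ≤ r)] (φ ψ : 𝓢(E, ℂ)) :
    (φ - ψ).toLp r (volume : Measure E) = φ.toLp r volume - ψ.toLp r volume :=
  map_sub (toLpCLM ℂ ℂ r (volume : Measure E)) φ ψ

/-- The products converge in `L¹` and in `L²`, and the sum of these two norms controls the `L^r`
norm of the inverse transform. -/
theorem cauchySeq_fourierInv_schwartzMul {r : ℝ≥0∞} [Fact (1 ≤ r)] (hr2 : 2 ≤ r) (hr : r ≠ ∞)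
    {ω : ℕ → 𝓢(E, ℂ)} {C : ℝ} (hC : ∀ j x, ‖ω j x‖ ≤ C) {U : Set E} (hU : MeasurableSet U)
    (hω : ∀ x, Tendsto (fun j => ω j x) atTop (𝓝 (U.indicator 1 x))) (φ : 𝓢(E, ℂ)) :
    CauchySeq fun j => (𝓕⁻ (schwartzMul (ω j) φ) : 𝓢(E, ℂ)).toLp r (volume : Measure E) := by
  have hc : ∀ s : ℝ≥0∞, [Fact (1 ≤ s)] → s ≠ ∞ →
      CauchySeq fun j => (schwartzMul (ω j) φ).toLp s (volume : Measure E) := by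
    intro s _ hs
    have hmem : MemLp (fun x => U.indicator 1 x * φ x) s (volume : Measure E) := by
      have : (fun x => U.indicator 1 x * φ x) = U.indicator φ := by
        ext x; by_cases hx : x ∈ U <;> simp [hx]
      rw [this]
      exact (φ.memLp s volume).indicator hU
    exact (tendsto_schwartzMul_toLp hs hC (Eventually.of_forall hω) φ hmem.coeFn_toLp).cauchySeq
  have h1 := cauchySeq_iff_tendsto_dist_atTop_0.1 (hc 1 (by simp))
  have h2 := cauchySeq_iff_tendsto_dist_atTop_0.1 (hc 2 (by simp))
  refine cauchySeq_iff_tendsto_dist_atTop_0.2 (squeeze_zero (fun _ => dist_nonneg) (fun n => ?_)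
    (by simpa using h1.add h2))
  rw [dist_eq_norm, dist_eq_norm, dist_eq_norm, ← toLp_fourierInv_sub, ← toLp_sub, ← toLp_sub]
  exact norm_fourierInv_toLp_le hr2 hr _

variable {p q : ℝ≥0∞} [Fact (1 ≤ p)] [Fact (1 ≤ q)] [ENNReal.HolderConjugate p q]

theorem map_tendsto_sub {r : ℝ≥0∞} [Fact (1 ≤ r)] {f : ℕ → Lp ℂ r (volume : Measure E)}
    {g h : Lp ℂ r (volume : Measure E)} (hf : Tendsto f atTop (𝓝 h))
    (L : Lp ℂ r (volume : Measure E) →L[ℂ] ℂ) :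
    Tendsto (fun j => L g - L (f j)) atTop (𝓝 (L (g - h))) := by
  rw [map_sub]
  exact ((L.continuous.tendsto h).comp hf).const_sub _

theorem pair_fourierInv_fourier (φ ψ : 𝓢(E, ℂ)) :
    pair p q ((𝓕⁻ φ : 𝓢(E, ℂ)).toLp p volume) ((𝓕 ψ : 𝓢(E, ℂ)).toLp q volume) = ∫ x, φ x * ψ x := by
  rw [pair_toLp_toLp, integral_fourierInv_mul_fourier]

theorem mem_spectralSubspace_of_pair_eq_setIntegral {K : Set E}
    {G : Lp ℂ p (volume : Measure E)} (φ : 𝓢(E, ℂ))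
    (h : ∀ θ : 𝓢(E, ℂ), pair p q G ((𝓕 θ : 𝓢(E, ℂ)).toLp q volume) = ∫ x in K, φ x * θ x) :
    G ∈ spectralSubspace p q K := by
  intro θ hθ
  rw [h]
  refine setIntegral_eq_zero_of_forall_eq_zero fun x hx => ?_
  have : θ x = 0 := by
    by_contra h
    exact hθ (subset_tsupport _ h) hx
  rw [this, mul_zero]

theorem tendsto_integral_sub_schwartzMul {χ : ℕ → 𝓢(E, ℂ)} {C : ℝ} (hC : ∀ j x, ‖χ j x‖ ≤ C)
    {K : Set E} (hK : MeasurableSet K)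
    (hχ : ∀ x, Tendsto (fun j => χ j x) atTop (𝓝 (Kᶜ.indicator 1 x))) (φ θ : 𝓢(E, ℂ)) :
    Tendsto (fun j => (∫ x, φ x * θ x) - ∫ x, schwartzMul (χ j) φ x * θ x) atTop
      (𝓝 (∫ x in K, φ x * θ x)) := by
  have h2 := (tendsto_integral_schwartzMul hC hK.compl hχ φ θ).const_sub (∫ x, φ x * θ x)
  have hi : Integrable fun x => φ x * θ x :=
    (schwartzMul φ θ).integrable.congr (Eventually.of_forall (schwartzMul_apply φ θ))
  have h3 := integral_add_compl hK hi
  rwa [show (∫ x, φ x * θ x) - ∫ x in Kᶜ, φ x * θ x = ∫ x in K, φ x * θ x from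
    sub_eq_of_eq_add h3.symm] at h2

theorem exists_tendsto_map_sub {f : ℕ → Lp ℂ p (volume : Measure E)} (hf : CauchySeq f)
    (g : Lp ℂ p (volume : Measure E)) : ∃ G : Lp ℂ p (volume : Measure E),
      ∀ L : Lp ℂ p (volume : Measure E) →L[ℂ] ℂ,
        Tendsto (fun j => L g - L (f j)) atTop (𝓝 (L G)) := by
  obtain ⟨h, hh⟩ := cauchySeq_tendsto_of_complete hf
  exact ⟨g - h, fun L => map_tendsto_sub hh L⟩

/-- The part of a function with spectrum in `K`, as an element of `L^p` with `p ≥ 2`. -/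
theorem exists_tendsto_spectralPart (hp2 : 2 ≤ p) (hp : p ≠ ∞) {K : Set E} (hK : IsClosed K)
    (φ : 𝓢(E, ℂ)) :
    ∃ (G : Lp ℂ p (volume : Measure E)) (χ : ℕ → 𝓢(E, ℂ)),
      (∀ j, tsupport (χ j) ⊆ Kᶜ) ∧ (∀ j x, ‖χ j x‖ ≤ 1) ∧
      (∀ x, Tendsto (fun j => χ j x) atTop (𝓝 (Kᶜ.indicator 1 x))) ∧
      ∀ L : Lp ℂ p (volume : Measure E) →L[ℂ] ℂ, Tendsto (fun j => L ((𝓕⁻ φ : 𝓢(E, ℂ)).toLp p volume) -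
        L ((𝓕⁻ (schwartzMul (χ j) φ) : 𝓢(E, ℂ)).toLp p volume)) atTop (𝓝 (L G)) := by
  obtain ⟨χ, hχs, hχ1, hχ⟩ := exists_cutoff_seq hK.isOpen_compl
  obtain ⟨G, hG⟩ := exists_tendsto_map_sub
    (cauchySeq_fourierInv_schwartzMul hp2 hp hχ1 hK.isOpen_compl.measurableSet hχ φ)
    ((𝓕⁻ φ : 𝓢(E, ℂ)).toLp p volume)
  exact ⟨G, χ, hχs, hχ1, hχ, hG⟩

/-- Here `G` plays the role of `𝓕⁻(χ_K φ)`: it lies in the spectral subspace, so `B` acts on it as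
the pairing. The discarded parts `𝓕⁻(χ_j φ)` contribute nothing, because the cutoff `χ_j` can be
moved onto `ψ`, where `B` vanishes. -/
theorem form_eq_setIntegral_of_two_le_left (hp2 : 2 ≤ p) (hp : p ≠ ∞) (hq : q ≠ ∞) {K : Set E}
    (hK : IsClosed K)
    {B : Lp ℂ p (volume : Measure E) →L[ℂ] Lp ℂ q (volume : Measure E) →L[ℂ] ℂ}
    (hB : ∀ y f g, B (translate p y f) (translate q y g) = B f g)
    (hB1 : ∀ f ∈ spectralSubspace p q K, ∀ g, B f g = pair p q f g)
    (hB2 : ∀ f (ψ : 𝓢(E, ℂ)), tsupport ψ ⊆ Kᶜ → B f ((𝓕 ψ : 𝓢(E, ℂ)).toLp q volume) = 0)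
    (φ ψ : 𝓢(E, ℂ)) :
    B ((𝓕⁻ φ : 𝓢(E, ℂ)).toLp p volume) ((𝓕 ψ : 𝓢(E, ℂ)).toLp q volume) = ∫ x in K, φ x * ψ x := by
  obtain ⟨G, χ, hχs, hχ1, hχ, hlim⟩ := exists_tendsto_spectralPart hp2 hp hK φ
  have hpair : ∀ θ : 𝓢(E, ℂ), pair p q G ((𝓕 θ : 𝓢(E, ℂ)).toLp q volume) = ∫ x in K, φ x * θ x := by
    intro θ
    rw [← ContinuousLinearMap.flip_apply]
    refine tendsto_nhds_unique (hlim ((pair p q).flip ((𝓕 θ : 𝓢(E, ℂ)).toLp q volume))) ?_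
    refine (tendsto_integral_sub_schwartzMul hχ1 hK.measurableSet hχ φ θ).congr fun j => ?_
    rw [ContinuousLinearMap.flip_apply, ContinuousLinearMap.flip_apply, pair_fourierInv_fourier,
      pair_fourierInv_fourier]
  rw [← hpair, ← hB1 G (mem_spectralSubspace_of_pair_eq_setIntegral φ hpair)]
  have h3 := hlim (B.flip ((𝓕 ψ : 𝓢(E, ℂ)).toLp q volume))
  simp only [ContinuousLinearMap.flip_apply] at h3
  refine tendsto_nhds_unique (tendsto_const_nhds.congr fun j => ?_) h3
  rw [form_fourierInv_mul hp hq hB,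
    hB2 _ _ ((tsupport_schwartzMul_subset _ _).trans (hχs j)), sub_zero]

/-- Approximation by functions whose spectrum avoids the boundary of `K`. -/
theorem exists_tendsto_of_null_frontier (hq2 : 2 ≤ q) (hq : q ≠ ∞) {K : Set E}
    (hK : IsClosed K) (hKf : volume (frontier K) = 0) (ψ : 𝓢(E, ℂ)) :
    ∃ η χ : ℕ → 𝓢(E, ℂ), (∀ j, tsupport (η j) ⊆ K) ∧ (∀ j, tsupport (χ j) ⊆ Kᶜ) ∧
      (∀ φ : 𝓢(E, ℂ), Tendsto (fun j => ∫ x, schwartzMul (η j) φ x * ψ x) atTop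
        (𝓝 (∫ x in K, φ x * ψ x))) ∧
      Tendsto (fun j => (𝓕 (schwartzMul (η j + χ j) ψ) : 𝓢(E, ℂ)).toLp q (volume : Measure E))
        atTop (𝓝 ((𝓕 ψ : 𝓢(E, ℂ)).toLp q volume)) := by
  obtain ⟨χ, hχs, hχ1, hχ⟩ := exists_cutoff_seq hK.isOpen_compl
  obtain ⟨η, hηs, hη1, hη⟩ := exists_cutoff_seq (isOpen_interior (s := K))
  have hfr : ∀ᵐ x : E, x ∉ frontier K := measure_eq_zero_iff_ae_notMem.1 hKf
  refine ⟨η, χ, fun j => (hηs j).trans interior_subset, hχs, fun φ => ?_, ?_⟩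
  · have hKi : K =ᵐ[volume] interior K := by
      filter_upwards [hfr] with x hx
      rw [hK.frontier_eq] at hx
      refine propext ⟨fun h => ?_, fun h => interior_subset h⟩
      by_contra h'; exact hx ⟨h, h'⟩
    rw [setIntegral_congr_set hKi]
    exact tendsto_integral_schwartzMul hη1 isOpen_interior.measurableSet hη φ ψ
  have hωC : ∀ j x, ‖(η j + χ j) x‖ ≤ 2 := fun j x => by
    rw [add_apply]
    linarith [norm_add_le (η j x) (χ j x), hη1 j x, hχ1 j x]
  have hω : ∀ᵐ x : E, Tendsto (fun j => (η j + χ j) x) atTop (𝓝 1) := by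
    filter_upwards [hfr] with x hx
    have h1 := (hη x).add (hχ x)
    have h2 : (interior K).indicator (1 : E → ℂ) x + Kᶜ.indicator 1 x = 1 := by
      rw [hK.frontier_eq] at hx
      by_cases hxK : x ∈ K
      · have : x ∈ interior K := by by_contra h; exact hx ⟨hxK, h⟩
        simp [hxK, this]
      · have : x ∉ interior K := fun h => hxK (interior_subset h)
        simp [hxK, this]
    rw [h2] at h1
    exact h1.congr fun j => (add_apply (η j) (χ j) x).symm
  have hconv : ∀ s : ℝ≥0∞, [Fact (1 ≤ s)] → s ≠ ∞ →
      Tendsto (fun j => ‖(schwartzMul (η j + χ j) ψ - ψ).toLp s (volume : Measure E)‖) atTop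
        (𝓝 0) := by
    intro s _ hs
    have := tendsto_schwartzMul_toLp hs hωC hω ψ (g := ψ.toLp s volume) (by
      simpa only [one_mul] using ψ.coeFn_toLp s volume)
    simpa only [toLp_sub] using tendsto_iff_norm_sub_tendsto_zero.1 this
  refine tendsto_iff_norm_sub_tendsto_zero.2 (squeeze_zero (fun _ => norm_nonneg _) (fun j => ?_)
    (by simpa using (hconv 1 (by simp)).add (hconv 2 (by simp))))
  rw [← toLp_fourier_sub]
  exact norm_fourier_toLp_le hq2 hq _

/-- The second argument is approximated by `𝓕((η_j + χ_j)ψ)`, with `η_j` living in `K` and `χ_j` off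
`K`. The `χ_j` part is killed by `B`; moving `η_j` onto `φ` puts the first argument in the spectral
subspace, where `B` is the pairing. -/
theorem form_eq_setIntegral_of_two_le_right (hq2 : 2 ≤ q) (hp : p ≠ ∞) (hq : q ≠ ∞) {K : Set E}
    (hK : IsClosed K) (hKf : volume (frontier K) = 0)
    {B : Lp ℂ p (volume : Measure E) →L[ℂ] Lp ℂ q (volume : Measure E) →L[ℂ] ℂ}
    (hB : ∀ y f g, B (translate p y f) (translate q y g) = B f g)
    (hB1 : ∀ f ∈ spectralSubspace p q K, ∀ g, B f g = pair p q f g)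
    (hB2 : ∀ f (ψ : 𝓢(E, ℂ)), tsupport ψ ⊆ Kᶜ → B f ((𝓕 ψ : 𝓢(E, ℂ)).toLp q volume) = 0)
    (φ ψ : 𝓢(E, ℂ)) :
    B ((𝓕⁻ φ : 𝓢(E, ℂ)).toLp p volume) ((𝓕 ψ : 𝓢(E, ℂ)).toLp q volume) = ∫ x in K, φ x * ψ x := by
  obtain ⟨η, χ, hη, hχ, hlim, hF⟩ := exists_tendsto_of_null_frontier hq2 hq hK hKf ψ
  have h1 := ((B ((𝓕⁻ φ : 𝓢(E, ℂ)).toLp p volume)).continuous.tendsto _).comp hF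
  refine tendsto_nhds_unique h1 ((hlim φ).congr fun j => ?_)
  have h2 : schwartzMul (η j + χ j) ψ - schwartzMul (χ j) ψ = schwartzMul (η j) ψ := by
    ext x
    simp only [sub_apply, add_apply, schwartzMul_apply]
    ring
  have h3 := hB2 ((𝓕⁻ φ : 𝓢(E, ℂ)).toLp p volume) (schwartzMul (χ j) ψ)
    ((tsupport_schwartzMul_subset _ _).trans (hχ j))
  have h4 := hB1 _ (fourierInv_mem_spectralSubspace (q := q) (K := K) (φ := schwartzMul (η j) φ)
    ((subset_tsupport _).trans ((tsupport_schwartzMul_subset _ _).trans (hη j))))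
    ((𝓕 ψ : 𝓢(E, ℂ)).toLp q volume)
  rw [form_fourierInv_mul hp hq hB, ← h2, toLp_fourier_sub, map_sub, h3, sub_zero, pair_toLp_toLp,
    integral_fourierInv_mul_fourier] at h4
  exact h4.symm

end FormIdentity

/-! ### The converse of Hölder's inequality. -/

section ConverseHolder

open Filter Topology

variable {α : Type*} {m : MeasurableSpace α} {μ : Measure α} {p q : ℝ≥0∞}

theorem memLp_indicator_of_bound {A : Set α} (hA : MeasurableSet A) (hμA : μ A ≠ ∞) {g : α → ℂ}
    (hg : StronglyMeasurable g) {M : ℝ} (hM : ∀ x ∈ A, ‖g x‖ ≤ M) (r : ℝ≥0∞) :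
    MemLp (A.indicator g) r μ := by
  rw [memLp_indicator_iff_restrict hA]
  have : IsFiniteMeasure (μ.restrict A) := ⟨by simpa using hμA.lt_top⟩
  exact MemLp.of_bound hg.aestronglyMeasurable M ((ae_restrict_iff' hA).2 (ae_of_all _ hM))

/-- The function dual to `u`. -/
noncomputable def dualFunction (s : ℝ) (u : α → ℂ) (x : α) : ℂ :=
  (starRingEnd ℂ) (u x) * ((‖u x‖ ^ (s - 2) : ℝ) : ℂ)

theorem mul_dualFunction {s : ℝ} (hs : 1 < s) (u : α → ℂ) (x : α) :
    u x * dualFunction s u x = ((‖u x‖ ^ s : ℝ) : ℂ) := by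
  rw [dualFunction, ← mul_assoc, Complex.mul_conj, Complex.normSq_eq_norm_sq, ← Complex.ofReal_mul]
  congr 1
  rcases (norm_nonneg (u x)).eq_or_lt with h | h
  · rw [← h]; simp [(by linarith : s ≠ 0)]
  · rw [← Real.rpow_natCast, ← Real.rpow_add h]; congr 1; push_cast; ring

theorem norm_dualFunction {s : ℝ} (hs : 1 < s) (u : α → ℂ) (x : α) :
    ‖dualFunction s u x‖ = ‖u x‖ ^ (s - 1) := by
  rw [dualFunction, norm_mul, RCLike.norm_conj, Complex.norm_real, Real.norm_eq_abs,
    abs_of_nonneg (by positivity)]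
  rcases (norm_nonneg (u x)).eq_or_lt with h | h
  · rw [← h]; simp [(by linarith : s - 1 ≠ 0)]
  · nth_rewrite 1 [← Real.rpow_one ‖u x‖]
    rw [← Real.rpow_add h]; congr 1; ring

theorem stronglyMeasurable_dualFunction {u : α → ℂ} (hu : StronglyMeasurable u) (s : ℝ) :
    StronglyMeasurable (dualFunction s u) := by
  refine Measurable.stronglyMeasurable ?_
  have := hu.measurable
  unfold dualFunction
  fun_prop

theorem eLpNorm_dualFunction [ENNReal.HolderConjugate p q] (hp1 : 1 < p) (hp : p ≠ ∞) (u : α → ℂ) :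
    eLpNorm (dualFunction p.toReal u) q μ = (∫⁻ x, ‖u x‖ₑ ^ p.toReal ∂μ) ^ (1 / q.toReal) := by
  have hs : 1 < p.toReal := by simpa using (ENNReal.toReal_lt_toReal (by simp) hp).2 hp1
  have hpq : p.toReal.HolderConjugate q.toReal :=
    ENNReal.HolderConjugate.toReal
      (by simpa using (ENNReal.toReal_lt_toReal (by simp) hp).2 hp1)
  have hq0 : q ≠ 0 := ENNReal.HolderConjugate.ne_zero q p
  have hq : q ≠ ∞ := by
    intro h; have := hpq.symm.pos; rw [h] at this; simp at this
  rw [eLpNorm_eq_lintegral_rpow_enorm_toReal hq0 hq]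
  congr 1
  refine lintegral_congr fun x => ?_
  rw [← ofReal_norm, norm_dualFunction hs, ← ofReal_norm,
    ENNReal.ofReal_rpow_of_nonneg (by positivity) (by positivity),
    ENNReal.ofReal_rpow_of_nonneg (by positivity) (by positivity), ← Real.rpow_mul (by positivity)]
  congr 2
  exact hpq.sub_one_mul_conj

/-- With `J = ∫ |u|^p` finite, divide `J ≤ C J^(1/q)` by `J^(1/q)`, using `1 - 1/q = 1/p`. -/
theorem eLpNorm_le_of_rpow_le [ENNReal.HolderConjugate p q] (hp1 : 1 < p) (hp : p ≠ ∞)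
    {u : α → ℂ} {C : ℝ} (hC : 0 ≤ C) (hJ : ∫⁻ x, ‖u x‖ₑ ^ p.toReal ∂μ ≠ ∞)
    (h : (∫⁻ x, ‖u x‖ₑ ^ p.toReal ∂μ).toReal ≤
      C * ((∫⁻ x, ‖u x‖ₑ ^ p.toReal ∂μ) ^ (1 / q.toReal)).toReal) :
    eLpNorm u p μ ≤ ENNReal.ofReal C := by
  have hpq : p.toReal.HolderConjugate q.toReal :=
    ENNReal.HolderConjugate.toReal
      (by simpa using (ENNReal.toReal_lt_toReal (by simp) hp).2 hp1)
  rw [eLpNorm_eq_lintegral_rpow_enorm_toReal (by positivity) hp]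
  set J := ∫⁻ x, ‖u x‖ₑ ^ p.toReal ∂μ
  have hJ' : J ^ (1 / p.toReal) ≠ ∞ := by
    have := hpq.pos
    exact ENNReal.rpow_ne_top_of_nonneg (by positivity) hJ
  rw [ENNReal.le_ofReal_iff_toReal_le hJ' hC, ← ENNReal.toReal_rpow]
  rw [← ENNReal.toReal_rpow] at h
  have hp0 := hpq.pos
  rcases (ENNReal.toReal_nonneg (a := J)).eq_or_lt with h0 | h0
  · rw [← h0, Real.zero_rpow (by positivity)]; exact hC
  · have h1 : J.toReal = J.toReal ^ (1 / p.toReal) * J.toReal ^ (1 / q.toReal) := by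
      rw [← Real.rpow_add h0, one_div, one_div, hpq.inv_add_inv_eq_one, Real.rpow_one]
    nth_rewrite 1 [h1] at h
    exact le_of_mul_le_mul_right h (by positivity)

/-- The converse of Hölder's inequality. -/
theorem eLpNorm_le_of_norm_integral_mul_le [ENNReal.HolderConjugate p q] (hp1 : 1 < p) (hp : p ≠ ∞)
    {h : α → ℂ} (hm : StronglyMeasurable h) {r : ℝ≥0∞} (hr0 : r ≠ 0) (hr : r ≠ ∞)
    (hh : MemLp h r μ) {C : ℝ} (hC : 0 ≤ C)
    (H : ∀ g : α → ℂ, (∀ t, MemLp g t μ) → ‖∫ x, h x * g x ∂μ‖ ≤ C * (eLpNorm g q μ).toReal) :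
    eLpNorm h p μ ≤ ENNReal.ofReal C := by
  have hs : 1 < p.toReal := by simpa using (ENNReal.toReal_lt_toReal (by simp) hp).2 hp1
  -- The lower bound gives `A n` finite measure because `h ∈ L^r`; the upper bound makes the
  -- truncation bounded. Its dual function is therefore an admissible `g`, and Fatou removes the
  -- truncation at the end.
  let A : ℕ → Set α := fun n => {x | ((n : ℝ) + 1)⁻¹ ≤ ‖h x‖ ∧ ‖h x‖ ≤ n}
  have hA : ∀ n, MeasurableSet (A n) := fun n =>
    (measurableSet_le measurable_const hm.norm.measurable).inter
      (measurableSet_le hm.norm.measurable measurable_const)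
  have hμA : ∀ n, μ (A n) ≠ ∞ := fun n => by
    refine (lt_of_le_of_lt (measure_mono fun x hx => ?_) (hh.meas_ge_lt_top' hr0 hr
      (ε := ENNReal.ofReal ((n : ℝ) + 1)⁻¹) (by simp; positivity))).ne
    change _ ≤ ‖h x‖ₑ
    rw [← ofReal_norm]
    exact ENNReal.ofReal_le_ofReal hx.1
  have hbound : ∀ n, eLpNorm ((A n).indicator h) p μ ≤ ENNReal.ofReal C := fun n => by
    set u := (A n).indicator h with hu
    have hum : ∀ t, MemLp u t μ := fun t =>
      memLp_indicator_of_bound (hA n) (hμA n) hm (M := n) (fun x hx => hx.2) t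
    have hg : dualFunction p.toReal u = (A n).indicator (dualFunction p.toReal h) := by
      ext x
      by_cases hx : x ∈ A n <;> simp [dualFunction, hu, hx]
    have hgm : ∀ t, MemLp (dualFunction p.toReal u) t μ := fun t => by
      rw [hg]
      refine memLp_indicator_of_bound (hA n) (hμA n) (stronglyMeasurable_dualFunction hm _)
        (M := (n : ℝ) ^ (p.toReal - 1)) (fun x hx => ?_) t
      rw [norm_dualFunction hs]
      exact Real.rpow_le_rpow (norm_nonneg _) hx.2 (by linarith)
    have hJ : ∫⁻ x, ‖u x‖ₑ ^ p.toReal ∂μ ≠ ∞ :=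
      (lintegral_rpow_enorm_lt_top_of_eLpNorm_lt_top (by positivity) hp (hum p).2).ne
    refine eLpNorm_le_of_rpow_le (q := q) hp1 hp hC hJ ?_
    have h1 := H _ hgm
    rw [eLpNorm_dualFunction hp1 hp] at h1
    refine le_trans (le_of_eq ?_) h1
    have h2 : ∀ x, h x * dualFunction p.toReal u x = ((‖u x‖ ^ p.toReal : ℝ) : ℂ) := fun x => by
      rw [← mul_dualFunction hs]
      by_cases hx : x ∈ A n <;> simp [dualFunction, hu, hx]
    simp_rw [h2]
    rw [integral_complex_ofReal, Complex.norm_real, Real.norm_eq_abs,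
      abs_of_nonneg (integral_nonneg fun x => by positivity),
      integral_eq_lintegral_of_nonneg_ae (ae_of_all _ fun x => by positivity)
        (((hm.indicator (hA n)).norm.measurable.pow_const _).aestronglyMeasurable)]
    congr 1
    refine lintegral_congr fun x => ?_
    rw [← ofReal_norm, ENNReal.ofReal_rpow_of_nonneg (by positivity) (by positivity)]
  have hlim : ∀ x, Tendsto (fun n => (A n).indicator h x) atTop (𝓝 (h x)) := fun x => by
    by_cases hx : h x = 0
    · refine tendsto_const_nhds.congr fun n => ?_
      by_cases hx' : x ∈ A n <;> simp [hx', hx]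
    · have h1 : ∀ᶠ n : ℕ in atTop, ((n : ℝ) + 1)⁻¹ ≤ ‖h x‖ := by
        have := tendsto_one_div_add_atTop_nhds_zero_nat (𝕜 := ℝ)
        simp only [one_div] at this
        exact (this.eventually (gt_mem_nhds (norm_pos_iff.2 hx))).mono fun _ h => le_of_lt h
      have h2 : ∀ᶠ n : ℕ in atTop, ‖h x‖ ≤ n := tendsto_natCast_atTop_atTop.eventually_ge_atTop _
      refine tendsto_const_nhds.congr' ?_
      filter_upwards [h1, h2] with n h1 h2
      exact (Set.indicator_of_mem (show x ∈ A n from ⟨h1, h2⟩) h).symm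
  refine (Lp.eLpNorm_lim_le_liminf_eLpNorm
    (fun n => (hm.indicator (hA n)).aestronglyMeasurable) h (ae_of_all _ hlim)).trans ?_
  refine liminf_le_of_le (by isBoundedDefault) fun b hb => ?_
  obtain ⟨n, hn⟩ := hb.exists
  exact hn.trans (hbound n)

end ConverseHolder

/-! ### Simultaneous density of Schwartz functions in `L^r ∩ L^s`. -/

section Bump

variable {E : Type*} [NormedAddCommGroup E] [InnerProductSpace ℝ E] [FiniteDimensional ℝ E]

theorem exists_schwartz_one_on_ball (R : ℝ) (hR : 0 < R) :
    ∃ χ : 𝓢(E, ℂ), (∀ x, ‖χ x‖ ≤ 1) ∧ (∀ x ∈ Metric.ball (0 : E) R, χ x = 1) ∧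
      ∀ x ∉ Metric.ball (0 : E) (R + 1), χ x = 0 := by
  let b : ContDiffBump (0 : E) := ⟨R, R + 1, hR, by linarith⟩
  have hC : ContDiff ℝ (⊤ : ℕ∞) (Complex.ofRealCLM ∘ b) :=
    Complex.ofRealCLM.contDiff.comp b.contDiff
  have hCc : HasCompactSupport (Complex.ofRealCLM ∘ b) := b.hasCompactSupport.comp_left rfl
  have h : ∀ x, hCc.toSchwartzMap hC x = ((b x : ℝ) : ℂ) := fun x => rfl
  refine ⟨hCc.toSchwartzMap hC, fun x => ?_, fun x hx => ?_, fun x hx => ?_⟩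
  · rw [h, Complex.norm_real, Real.norm_eq_abs, abs_of_nonneg b.nonneg]
    exact b.le_one
  · rw [h, b.one_of_mem_closedBall (Metric.ball_subset_closedBall hx), Complex.ofReal_one]
  · rw [h, b.zero_of_le_dist (by simpa using hx), Complex.ofReal_zero]

end Bump

section SimultaneousDensity

open Filter Topology

variable {E : Type*} [NormedAddCommGroup E] [InnerProductSpace ℝ E] [FiniteDimensional ℝ E]
  [MeasurableSpace E] [BorelSpace E]

theorem exists_schwartz_eLpNorm_sub_le {r : ℝ≥0∞} (hr1 : 1 ≤ r) (hr : r ≠ ∞) {f : E → ℂ}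
    (hf : MemLp f r volume) {ε : ℝ} (hε : 0 < ε) :
    ∃ θ : 𝓢(E, ℂ), eLpNorm (f - ⇑θ) r volume ≤ ENNReal.ofReal ε := by
  obtain ⟨g, hg1, hg2, hg3⟩ := MemLp.exist_eLpNorm_sub_le hr hr1 hf hε
  exact ⟨hg1.toSchwartzMap hg2, hg3⟩

/-- Functions of bounded support are approximated in two norms at once. -/
theorem exists_schwartz_eLpNorm_sub_le_of_ball {r s : ℝ≥0∞} (hr1 : 1 ≤ r) (hrs : r ≤ s)
    (hs : s ≠ ∞) {f : E → ℂ} (hf : MemLp f s volume) {R : ℝ} (hR : 0 < R)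
    (hfR : ∀ x ∉ Metric.ball (0 : E) R, f x = 0) {ε : ℝ} (hε : 0 < ε) :
    ∃ θ : 𝓢(E, ℂ), eLpNorm (f - ⇑θ) r volume ≤ ENNReal.ofReal ε ∧
      eLpNorm (f - ⇑θ) s volume ≤ ENNReal.ofReal ε := by
  obtain ⟨χ, hχ1, hχR, hχ0⟩ := exists_schwartz_one_on_ball (E := E) R hR
  set S := Metric.ball (0 : E) (R + 1)
  have hS : volume S ≠ ∞ := measure_ball_lt_top.ne
  -- The constant of the embedding of `L^s(S)` into `L^r(S)`; the choice of `δ` below absorbs it.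
  set M := volume S ^ (1 / r.toReal - 1 / s.toReal)
  have hr0 : 0 < r.toReal := ENNReal.toReal_pos (by positivity) (ne_top_of_le_ne_top hs hrs)
  have hM : M ≠ ∞ := ENNReal.rpow_ne_top_of_nonneg (sub_nonneg.2
    (one_div_le_one_div_of_le hr0 (ENNReal.toReal_mono hs hrs))) hS
  set δ := ε / (1 + M.toReal)
  have hMpos : 0 < 1 + M.toReal := by positivity
  have hδ : 0 < δ := div_pos hε hMpos
  obtain ⟨θ, hθ⟩ := exists_schwartz_eLpNorm_sub_le (hr1.trans hrs) hs hf hδ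
  have hfχ : ∀ x, (f - ⇑(schwartzMul χ θ)) x = χ x * (f - ⇑θ) x := fun x => by
    rw [Pi.sub_apply, Pi.sub_apply, schwartzMul_apply]
    by_cases hx : x ∈ Metric.ball (0 : E) R
    · rw [hχR x hx]; ring
    · rw [hfR x hx]; ring
  have hsS : eLpNorm (f - ⇑(schwartzMul χ θ)) s volume ≤ ENNReal.ofReal δ := by
    refine (eLpNorm_mono fun x => ?_).trans hθ
    rw [hfχ, norm_mul]
    exact mul_le_of_le_one_left (norm_nonneg _) (hχ1 x)
  have hδε : δ ≤ ε := div_le_self hε.le (by simp)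
  refine ⟨schwartzMul χ θ, ?_, hsS.trans (ENNReal.ofReal_le_ofReal hδε)⟩
  have hsupp : Function.support (f - ⇑(schwartzMul χ θ)) ⊆ S := fun x hx => by
    by_contra h
    exact hx (by rw [hfχ, hχ0 x h, zero_mul])
  rw [← eLpNorm_restrict_eq_of_support_subset hsupp]
  refine (eLpNorm_le_eLpNorm_mul_rpow_measure_univ hrs
    (hf.1.sub (schwartzMul χ θ).continuous.aestronglyMeasurable).restrict).trans ?_
  rw [eLpNorm_restrict_eq_of_support_subset hsupp, Measure.restrict_apply_univ]
  refine (mul_le_mul_left hsS _).trans ?_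
  change _ * M ≤ _
  rw [← ENNReal.ofReal_toReal hM, ← ENNReal.ofReal_mul hδ.le]
  refine ENNReal.ofReal_le_ofReal ?_
  change ε / (1 + M.toReal) * M.toReal ≤ ε
  rw [div_mul_eq_mul_div, div_le_iff₀ hMpos]
  nlinarith

theorem tendsto_eLpNorm_sub_indicator_ball {r : ℝ≥0∞} (hr0 : r ≠ 0) (hr : r ≠ ∞) {f : E → ℂ}
    (hf : MemLp f r volume) :
    Tendsto (fun n : ℕ => eLpNorm (f - (Metric.ball (0 : E) (n + 1)).indicator f) r volume) atTop
      (𝓝 0) := by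
  have h := tendsto_eLpNorm_sub_of_dominated (g := f) (G := f)
    (f := fun n : ℕ => (Metric.ball (0 : E) (n + 1)).indicator f) hr0 hr
    (fun n => hf.1.indicator measurableSet_ball) hf
    (fun n => ae_of_all _ fun x => norm_indicator_le_norm_self f x) (ae_of_all _ fun x => by
      refine tendsto_const_nhds.congr' ?_
      filter_upwards [(tendsto_natCast_atTop_atTop (R := ℝ)).eventually_ge_atTop ‖x‖] with n hn
      rw [Set.indicator_of_mem]
      rw [mem_ball_zero_iff]
      linarith)
  exact h.congr fun n => eLpNorm_sub_comm _ _ _ _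

theorem exists_schwartz_eLpNorm_sub_le_of_le {r s : ℝ≥0∞} (hr1 : 1 ≤ r) (hrs : r ≤ s)
    (hs : s ≠ ∞) {f : E → ℂ} (hfr : MemLp f r volume) (hfs : MemLp f s volume)
    {ε : ℝ} (hε : 0 < ε) :
    ∃ θ : 𝓢(E, ℂ), eLpNorm (f - ⇑θ) r volume ≤ ENNReal.ofReal ε ∧
      eLpNorm (f - ⇑θ) s volume ≤ ENNReal.ofReal ε := by
  have hs1 := hr1.trans hrs
  have hr : r ≠ ∞ := ne_top_of_le_ne_top hs hrs
  have hε2 : 0 < ε / 2 := by positivity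
  have hE : (0 : ℝ≥0∞) < ENNReal.ofReal (ε / 2) := by simpa using hε
  obtain ⟨n, h1, h2⟩ := (((tendsto_eLpNorm_sub_indicator_ball (by positivity) hr hfr).eventually
    (ge_mem_nhds hE)).and ((tendsto_eLpNorm_sub_indicator_ball (by positivity) hs hfs).eventually
    (ge_mem_nhds hE))).exists
  set u := (Metric.ball (0 : E) (n + 1)).indicator f
  have hu : ∀ {t}, MemLp f t volume → MemLp u t volume := fun h => h.indicator measurableSet_ball
  obtain ⟨θ, h3, h4⟩ := exists_schwartz_eLpNorm_sub_le_of_ball hr1 hrs hs (hu hfs)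
    (R := n + 1) (by positivity) (fun x hx => Set.indicator_of_notMem hx f) hε2
  have key : ∀ t, 1 ≤ t → MemLp f t volume → eLpNorm (f - u) t volume ≤ ENNReal.ofReal (ε / 2) →
      eLpNorm (u - ⇑θ) t volume ≤ ENNReal.ofReal (ε / 2) →
      eLpNorm (f - ⇑θ) t volume ≤ ENNReal.ofReal ε := fun t ht hf ha hb => by
    rw [← sub_add_sub_cancel f u ⇑θ, ← add_halves ε, ENNReal.ofReal_add hε2.le hε2.le]
    exact (eLpNorm_add_le (hf.1.sub (hu hf).1)
      ((hu hf).1.sub θ.continuous.aestronglyMeasurable) ht).trans (add_le_add ha hb)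
  exact ⟨θ, key r hr1 hfr h1 h3, key s hs1 hfs h2 h4⟩

/-- Schwartz functions are dense in `L^r ∩ L^s`. -/
theorem exists_schwartz_tendsto_toLp {r s : ℝ≥0∞} [Fact (1 ≤ r)] [Fact (1 ≤ s)] (hr : r ≠ ∞)
    (hs : s ≠ ∞) {f : E → ℂ} (hfr : MemLp f r volume) (hfs : MemLp f s volume) :
    ∃ θ : ℕ → 𝓢(E, ℂ), Tendsto (fun j => (θ j).toLp r volume) atTop (𝓝 (hfr.toLp f)) ∧
      Tendsto (fun j => (θ j).toLp s volume) atTop (𝓝 (hfs.toLp f)) := by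
  have h : ∀ j : ℕ, ∃ θ : 𝓢(E, ℂ),
      eLpNorm (f - ⇑θ) r volume ≤ ENNReal.ofReal (1 / ((j : ℝ) + 1)) ∧
      eLpNorm (f - ⇑θ) s volume ≤ ENNReal.ofReal (1 / ((j : ℝ) + 1)) := fun j => by
    have hj : 0 < 1 / ((j : ℝ) + 1) := by positivity
    rcases le_total r s with hrs | hrs
    · exact exists_schwartz_eLpNorm_sub_le_of_le Fact.out hrs hs hfr hfs hj
    · obtain ⟨θ, h1, h2⟩ := exists_schwartz_eLpNorm_sub_le_of_le Fact.out hrs hr hfs hfr hj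
      exact ⟨θ, h2, h1⟩
  choose θ h1 h2 using h
  have key : ∀ {t : ℝ≥0∞} [Fact (1 ≤ t)] (hf : MemLp f t volume),
      (∀ j : ℕ, eLpNorm (f - ⇑(θ j)) t volume ≤ ENNReal.ofReal (1 / ((j : ℝ) + 1))) →
      Tendsto (fun j => (θ j).toLp t volume) atTop (𝓝 (hf.toLp f)) := fun {t} _ hf h => by
    refine tendsto_iff_dist_tendsto_zero.2 (squeeze_zero (fun _ => dist_nonneg) (fun j => ?_)
      (tendsto_one_div_add_atTop_nhds_zero_nat (𝕜 := ℝ)))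
    rw [dist_comm, dist_eq_norm, SchwartzMap.toLp, ← MemLp.toLp_sub, Lp.norm_toLp]
    exact ENNReal.toReal_le_of_le_ofReal (by positivity) (h j)
  exact ⟨θ, key hfr h1, key hfs h2⟩

end SimultaneousDensity

/-! ### The multiplier `χ_K` on `L²`. -/

section SpectralCut

open Filter Topology

variable {E : Type*} [NormedAddCommGroup E] [InnerProductSpace ℝ E] [FiniteDimensional ℝ E]
  [MeasurableSpace E] [BorelSpace E] {K : Set E}

theorem memLp_top_indicator_one (hK : MeasurableSet K) :
    MemLp (K.indicator fun _ => (1 : ℂ)) ∞ (volume : Measure E) :=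
  (memLp_top_const (1 : ℂ)).indicator hK

/-- Multiplication by the indicator function of `K` on `L²`. -/
noncomputable def indicatorMul (hK : MeasurableSet K) :
    Lp ℂ 2 (volume : Measure E) →L[ℂ] Lp ℂ 2 (volume : Measure E) :=
  (ContinuousLinearMap.mul ℂ ℂ).holderL volume ∞ 2 2
    ((memLp_top_indicator_one hK).toLp (K.indicator fun _ => (1 : ℂ)))

theorem coeFn_indicatorMul (hK : MeasurableSet K) (f : Lp ℂ 2 (volume : Measure E)) :
    indicatorMul hK f =ᵐ[volume] K.indicator f := by
  have h : indicatorMul hK f =ᵐ[volume] fun x => ContinuousLinearMap.mul ℂ ℂ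
      ((memLp_top_indicator_one hK).toLp (K.indicator fun _ => (1 : ℂ)) x) (f x) :=
    (ContinuousLinearMap.mul ℂ ℂ).coeFn_holder (r := 2)
      ((memLp_top_indicator_one hK).toLp (K.indicator fun _ => (1 : ℂ))) f
  filter_upwards [h, (memLp_top_indicator_one hK).coeFn_toLp] with x h1 h2
  rw [h1, h2]
  by_cases hx : x ∈ K <;> simp [hx]

/-- The operator `f ↦ 𝓕⁻ (χ_K 𝓕 f)` on `L²`. -/
noncomputable def spectralCut (hK : MeasurableSet K) :
    Lp ℂ 2 (volume : Measure E) →L[ℂ] Lp ℂ 2 (volume : Measure E) :=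
  (fourierInvCLM ℂ (Lp ℂ 2 (volume : Measure E))) ∘L indicatorMul hK ∘L
    (fourierCLM ℂ (Lp ℂ 2 (volume : Measure E)))

theorem spectralCut_apply (hK : MeasurableSet K) (f : Lp ℂ 2 (volume : Measure E)) :
    spectralCut hK f = 𝓕⁻ (indicatorMul hK (𝓕 f)) := rfl

theorem fourier_spectralCut (hK : MeasurableSet K) (f : Lp ℂ 2 (volume : Measure E)) :
    (𝓕 (spectralCut hK f) : Lp ℂ 2 (volume : Measure E)) =ᵐ[volume]
      K.indicator (𝓕 f : Lp ℂ 2 (volume : Measure E)) := by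
  rw [spectralCut_apply, fourier_fourierInv_eq]
  exact coeFn_indicatorMul hK _

theorem integral_fourierInv_mul_fourier_toLp (h : Lp ℂ 2 (volume : Measure E)) (ψ : 𝓢(E, ℂ)) :
    pair 2 2 (𝓕⁻ h : Lp ℂ 2 (volume : Measure E)) ((𝓕 ψ : 𝓢(E, ℂ)).toLp 2 volume) =
      ∫ x, h x * ψ x := by
  have h1 := congrArg (fun u : 𝓢'(E, ℂ) => u (𝓕 ψ)) (Lp.fourierInv_toTemperedDistribution_eq h)
  simp only [TemperedDistribution.fourierInv_apply, Lp.toTemperedDistribution_apply,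
    fourierInv_fourier_eq, smul_eq_mul] at h1
  rw [pair_toLp_right]
  simpa only [mul_comm] using h1.symm

theorem pair_spectralCut_toLp (hK : MeasurableSet K) (φ ψ : 𝓢(E, ℂ)) :
    pair 2 2 (spectralCut hK ((𝓕⁻ φ : 𝓢(E, ℂ)).toLp 2 volume))
      ((𝓕 ψ : 𝓢(E, ℂ)).toLp 2 volume) = ∫ x in K, φ x * ψ x := by
  rw [spectralCut_apply, integral_fourierInv_mul_fourier_toLp, SchwartzMap.toLp_fourier_eq,
    fourier_fourierInv_eq, ← integral_indicator hK]
  refine integral_congr_ae ?_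
  filter_upwards [coeFn_indicatorMul hK (φ.toLp 2 volume), φ.coeFn_toLp 2 volume] with x h1 h2
  rw [h1]
  by_cases hx : x ∈ K <;> simp [hx, h2]

end SpectralCut

/-! ### From the bilinear form to a bounded operator on `L^p`. -/

section Multiplier

open Filter Topology

variable {E : Type*} [NormedAddCommGroup E] [InnerProductSpace ℝ E] [FiniteDimensional ℝ E]
  [MeasurableSpace E] [BorelSpace E] {p q : ℝ≥0∞} [Fact (1 ≤ p)] [Fact (1 ≤ q)] {K : Set E}

theorem form_toLp_eq_pair_spectralCut (hK : MeasurableSet K)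
    {B : Lp ℂ p (volume : Measure E) →L[ℂ] Lp ℂ q (volume : Measure E) →L[ℂ] ℂ}
    (hB : ∀ φ ψ : 𝓢(E, ℂ), B ((𝓕⁻ φ : 𝓢(E, ℂ)).toLp p volume)
      ((𝓕 ψ : 𝓢(E, ℂ)).toLp q volume) = ∫ x in K, φ x * ψ x) (φ ψ : 𝓢(E, ℂ)) :
    B (φ.toLp p volume) (ψ.toLp q volume) =
      pair 2 2 (spectralCut hK (φ.toLp 2 volume)) (ψ.toLp 2 volume) := by
  have h1 := hB (𝓕 φ) (𝓕⁻ ψ)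
  rw [← pair_spectralCut_toLp hK] at h1
  simpa only [fourierInv_fourier_eq, fourier_fourierInv_eq] using h1

/-- One Schwartz sequence approximates `f` in both `L^p` and `L²`, and another approximates `g` in
both `L^q` and `L²`, so both sides pass to the limit together. -/
theorem form_memLp_eq_pair_spectralCut (hp : p ≠ ∞) (hq : q ≠ ∞) (hK : MeasurableSet K)
    {B : Lp ℂ p (volume : Measure E) →L[ℂ] Lp ℂ q (volume : Measure E) →L[ℂ] ℂ}
    (hB : ∀ φ ψ : 𝓢(E, ℂ), B ((𝓕⁻ φ : 𝓢(E, ℂ)).toLp p volume)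
      ((𝓕 ψ : 𝓢(E, ℂ)).toLp q volume) = ∫ x in K, φ x * ψ x) {f g : E → ℂ}
    (hfp : MemLp f p volume) (hf2 : MemLp f 2 volume) (hgq : MemLp g q volume)
    (hg2 : MemLp g 2 volume) :
    B (hfp.toLp f) (hgq.toLp g) = pair 2 2 (spectralCut hK (hf2.toLp f)) (hg2.toLp g) := by
  obtain ⟨φ, h1, h2⟩ := exists_schwartz_tendsto_toLp hp (by simp) hfp hf2
  obtain ⟨ψ, h3, h4⟩ := exists_schwartz_tendsto_toLp hq (by simp) hgq hg2
  have h5 := (B.continuous₂.tendsto (hfp.toLp f, hgq.toLp g)).comp (h1.prodMk_nhds h3)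
  have h6 := ((pair 2 2).continuous₂.tendsto (spectralCut hK (hf2.toLp f), hg2.toLp g)).comp
    ((((spectralCut hK).continuous.tendsto _).comp h2).prodMk_nhds h4)
  refine tendsto_nhds_unique h5 (h6.congr fun j => ?_)
  exact (form_toLp_eq_pair_spectralCut hK hB (φ j) (ψ j)).symm

theorem eLpNorm_spectralCut_le [ENNReal.HolderConjugate p q] (hp1 : 1 < p) (hp : p ≠ ∞)
    (hq : q ≠ ∞) (hK : MeasurableSet K)
    {B : Lp ℂ p (volume : Measure E) →L[ℂ] Lp ℂ q (volume : Measure E) →L[ℂ] ℂ}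
    (hB : ∀ φ ψ : 𝓢(E, ℂ), B ((𝓕⁻ φ : 𝓢(E, ℂ)).toLp p volume)
      ((𝓕 ψ : 𝓢(E, ℂ)).toLp q volume) = ∫ x in K, φ x * ψ x) {f : E → ℂ}
    (hfp : MemLp f p volume) (hf2 : MemLp f 2 volume) :
    eLpNorm (spectralCut hK (hf2.toLp f)) p volume ≤ ENNReal.ofReal (‖B‖ * ‖hfp.toLp f‖) := by
  refine eLpNorm_le_of_norm_integral_mul_le (q := q) hp1 hp (Lp.stronglyMeasurable _)
    (r := 2) (by simp) (by simp) (Lp.memLp _) (by positivity) fun g hg => ?_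
  have h := form_memLp_eq_pair_spectralCut hp hq hK hB hfp hf2 (hg q) (hg 2)
  rw [pair_eq_integral] at h
  have h2 : ∫ x, spectralCut hK (hf2.toLp f) x * g x =
      ∫ x, spectralCut hK (hf2.toLp f) x * (hg 2).toLp g x := integral_congr_ae (by
    filter_upwards [(hg 2).coeFn_toLp] with x hx
    rw [hx])
  rw [h2, ← h, ← Lp.norm_toLp g (hg q)]
  exact B.le_opNorm₂ _ _

/-- Used twice: for Schwartz `f` it defines the operator, and for general `f ∈ L² ∩ L^p` it
identifies the extension. -/
theorem exists_representing [ENNReal.HolderConjugate p q] (hp1 : 1 < p) (hp : p ≠ ∞)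
    (hq : q ≠ ∞) (hK : MeasurableSet K)
    {B : Lp ℂ p (volume : Measure E) →L[ℂ] Lp ℂ q (volume : Measure E) →L[ℂ] ℂ}
    (hB : ∀ φ ψ : 𝓢(E, ℂ), B ((𝓕⁻ φ : 𝓢(E, ℂ)).toLp p volume)
      ((𝓕 ψ : 𝓢(E, ℂ)).toLp q volume) = ∫ x in K, φ x * ψ x) {f : E → ℂ}
    (hfp : MemLp f p volume) (hf2 : MemLp f 2 volume) :
    ∃ h : Lp ℂ p (volume : Measure E), h =ᵐ[volume] spectralCut hK (hf2.toLp f) ∧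
      ‖h‖ ≤ ‖B‖ * ‖hfp.toLp f‖ ∧
      ∀ θ : 𝓢(E, ℂ), pair p q h (θ.toLp q volume) = B (hfp.toLp f) (θ.toLp q volume) := by
  have hle := eLpNorm_spectralCut_le hp1 hp hq hK hB hfp hf2
  have hm : MemLp (spectralCut hK (hf2.toLp f)) p volume :=
    ⟨Lp.aestronglyMeasurable _, hle.trans_lt ENNReal.ofReal_lt_top⟩
  refine ⟨hm.toLp _, hm.coeFn_toLp, ?_, fun θ => ?_⟩
  · rw [Lp.norm_toLp]
    exact ENNReal.toReal_le_of_le_ofReal (by positivity) hle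
  · have h := form_memLp_eq_pair_spectralCut hp hq hK hB hfp hf2 (θ.memLp q volume)
      (θ.memLp 2 volume)
    change B _ (θ.toLp q volume) = pair 2 2 _ (θ.toLp 2 volume) at h
    rw [h, pair_toLp_right, pair_toLp_right]
    refine integral_congr_ae ?_
    filter_upwards [hm.coeFn_toLp] with x hx
    rw [hx]

/-- A bilinear form on `L^p × L^q` given by `χ_K` on the Fourier side yields a multiplier. -/
theorem exists_multiplier [ENNReal.HolderConjugate p q] (hp1 : 1 < p) (hp : p ≠ ∞)
    (hq : q ≠ ∞) (hK : MeasurableSet K)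
    {B : Lp ℂ p (volume : Measure E) →L[ℂ] Lp ℂ q (volume : Measure E) →L[ℂ] ℂ}
    (hB : ∀ φ ψ : 𝓢(E, ℂ), B ((𝓕⁻ φ : 𝓢(E, ℂ)).toLp p volume)
      ((𝓕 ψ : 𝓢(E, ℂ)).toLp q volume) = ∫ x in K, φ x * ψ x) :
    ∃ T : Lp ℂ p (volume : Measure E) →L[ℂ] Lp ℂ p (volume : Measure E),
      ∀ (f : E → ℂ) (hfp : MemLp f p volume) (hf2 : MemLp f 2 volume),
        T (hfp.toLp f) =ᵐ[volume] spectralCut hK (hf2.toLp f) := by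
  have hS : ∀ φ : 𝓢(E, ℂ), ∃ h : Lp ℂ p (volume : Measure E), ‖h‖ ≤ ‖B‖ * ‖φ.toLp p volume‖ ∧
      ∀ θ : 𝓢(E, ℂ), pair p q h (θ.toLp q volume) = B (φ.toLp p volume) (θ.toLp q volume) :=
    fun φ => by
      obtain ⟨h, -, h1, h2⟩ := exists_representing hp1 hp hq hK hB (φ.memLp p volume)
        (φ.memLp 2 volume)
      exact ⟨h, h1, h2⟩
  choose S hS1 hS2 using hS
  let e : 𝓢(E, ℂ) →ₗ[ℂ] Lp ℂ p (volume : Measure E) := (toLpCLM ℂ ℂ p volume).toLinearMap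
  have he : ∀ φ, e φ = φ.toLp p volume := fun φ => rfl
  let L : 𝓢(E, ℂ) →ₗ[ℂ] Lp ℂ p (volume : Measure E) :=
    { toFun := S
      map_add' := fun φ ψ => eq_of_pair_toLp_eq (q := q) fun θ => by
        rw [map_add, add_apply, hS2, hS2, hS2, ← he, ← he, ← he, map_add, map_add, add_apply]
      map_smul' := fun c φ => eq_of_pair_toLp_eq (q := q) fun θ => by
        rw [map_smul, smul_apply, hS2, hS2, ← he, ← he, map_smul, RingHom.id_apply, map_smul,
          smul_apply] }
  have hd : DenseRange e := denseRange_toLpCLM (F := ℂ) (μ := (volume : Measure E)) hp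
  have hn : ∀ φ, ‖L φ‖ ≤ ‖B‖ * ‖e φ‖ := hS1
  refine ⟨L.extendOfNorm e, fun f hfp hf2 => ?_⟩
  obtain ⟨h, h1, -, h2⟩ := exists_representing hp1 hp hq hK hB hfp hf2
  rw [eq_of_pair_toLp_eq (q := q) (f := L.extendOfNorm e (hfp.toLp f)) (g := h) fun θ => ?_]
  · exact h1
  rw [h2]
  -- Both functionals of `g` are continuous on `L^p` and agree on the dense image of the Schwartz
  -- space.
  have hc := hd.equalizer (g := fun g => pair p q (L.extendOfNorm e g) (θ.toLp q volume))
    (h := fun g => B g (θ.toLp q volume))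
    (((pair p q).flip (θ.toLp q volume)).continuous.comp (L.extendOfNorm e).continuous)
    ((B.flip (θ.toLp q volume)).continuous) (funext fun φ => by
      simp only [Function.comp_apply]
      rw [L.extendOfNorm_eq hd ⟨_, hn⟩]
      exact hS2 φ θ)
  exact congrFun hc _

end Multiplier

/-! ### Passage between the two normalisations of the Fourier transform. -/

section Bandlimited

variable {n : ℕ}

/-- The dilation of `θ` cancels the one built into `schwartzFourier`, leaving only the Jacobian. -/
theorem schwartzFourier_comp_scaleEquiv (θ : 𝓢(EuclideanSpace ℝ (Fin n), ℂ)) :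
    ∃ c : ℂ, c ≠ 0 ∧ ∀ ξ, schwartzFourier n
      (compCLMOfContinuousLinearEquiv ℂ (scaleEquiv n) θ) ξ =
        c * (𝓕 θ : 𝓢(EuclideanSpace ℝ (Fin n), ℂ)) ξ := by
  set s := (2 * Real.pi)⁻¹ with hs
  have hs0 : s ≠ 0 := inv_ne_zero (by positivity)
  refine ⟨((|(s ^ Module.finrank ℝ (EuclideanSpace ℝ (Fin n)))⁻¹| : ℝ) : ℂ), ?_, fun ξ => ?_⟩
  · rw [Complex.ofReal_ne_zero, abs_ne_zero]
    exact inv_ne_zero (pow_ne_zero _ hs0)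
  · have h1 : schwartzFourier n (compCLMOfContinuousLinearEquiv ℂ (scaleEquiv n) θ) ξ =
        𝓕 (fun x => θ (s • x)) (s • ξ) := rfl
    have h2 : (𝓕 θ : 𝓢(EuclideanSpace ℝ (Fin n), ℂ)) ξ =
        𝓕 (θ : EuclideanSpace ℝ (Fin n) → ℂ) ξ := rfl
    rw [h1, h2, Real.fourier_eq, Real.fourier_eq, ← Complex.real_smul,
      ← Measure.integral_comp_smul volume _ s]
    refine integral_congr_ae (ae_of_all _ fun x => ?_)
    simp only [inner_smul_left, inner_smul_right, RCLike.conj_to_real]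

theorem tsupport_comp_scaleEquiv (θ : 𝓢(EuclideanSpace ℝ (Fin n), ℂ)) :
    tsupport (compCLMOfContinuousLinearEquiv ℂ (scaleEquiv n) θ) =
      scaleEquiv n ⁻¹' tsupport θ :=
  tsupport_comp_eq_preimage θ (scaleEquiv n).toHomeomorph

variable {p q : ℝ≥0∞} [Fact (1 ≤ p)] [Fact (1 ≤ q)] [ENNReal.HolderConjugate p q]

theorem distFourier_toTemperedDistribution_comp_scaleEquiv
    (f : Lp ℂ p (volume : Measure (EuclideanSpace ℝ (Fin n))))
    (θ : 𝓢(EuclideanSpace ℝ (Fin n), ℂ)) :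
    distFourier (Lp.toTemperedDistribution f)
      (compCLMOfContinuousLinearEquiv ℂ (scaleEquiv n) θ) = 0 ↔
      pair p q f ((𝓕 θ : 𝓢(EuclideanSpace ℝ (Fin n), ℂ)).toLp q volume) = 0 := by
  obtain ⟨c, hc, h⟩ := schwartzFourier_comp_scaleEquiv θ
  rw [distFourier_apply, Lp.toTemperedDistribution_apply, pair_toLp_right]
  have h1 : ∀ x, schwartzFourier n (compCLMOfContinuousLinearEquiv ℂ (scaleEquiv n) θ) x • f x =
      c * (f x * (𝓕 θ : 𝓢(EuclideanSpace ℝ (Fin n), ℂ)) x) := fun x => by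
    rw [h, smul_eq_mul]; ring
  simp_rw [h1]
  rw [integral_const_mul, mul_eq_zero, or_iff_right hc]

theorem mem_bandlimited_iff {K : Set (EuclideanSpace ℝ (Fin n))}
    (f : Lp ℂ p (volume : Measure (EuclideanSpace ℝ (Fin n)))) :
    f ∈ bandlimited p K ↔ f ∈ spectralSubspace p q (scaleEquiv n '' K) := by
  constructor
  · intro hf θ hθ
    rw [← distFourier_toTemperedDistribution_comp_scaleEquiv]
    refine hf _ ?_
    rw [tsupport_comp_scaleEquiv]
    exact fun x hx hxK => hθ hx (Set.mem_image_of_mem _ hxK)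
  · intro hf ψ hψ
    have h : ψ = compCLMOfContinuousLinearEquiv ℂ (scaleEquiv n)
        (compCLMOfContinuousLinearEquiv ℂ (scaleEquiv n).symm ψ) := by
      ext x
      simp
    rw [h] at hψ ⊢
    rw [distFourier_toTemperedDistribution_comp_scaleEquiv (q := q)]
    rw [tsupport_comp_scaleEquiv] at hψ
    refine hf _ ?_
    rintro x hx ⟨y, hy, rfl⟩
    exact hψ hx hy

theorem volume_frontier_image_scaleEquiv {K : Set (EuclideanSpace ℝ (Fin n))}
    (h : volume (frontier K) = 0) : volume (frontier (scaleEquiv n '' K)) = 0 := by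
  have h1 : frontier (scaleEquiv n '' K) = scaleEquiv n '' frontier K :=
    ((scaleEquiv n).toHomeomorph.image_frontier K).symm
  rw [h1, Measure.addHaar_image_continuousLinearEquiv, h, mul_zero]

/-- The pairings with translates of `𝓕 ω` form a continuous representative of `f`, and continuous
representatives are unique. Point evaluation is thus expressed by functionals defined on all of
`L^p`. -/
theorem exists_continuous_iff_pair_translate (hq : q ≠ ∞) {K Λ : Set (EuclideanSpace ℝ (Fin n))}
    {ω : 𝓢(EuclideanSpace ℝ (Fin n), ℂ)} (hω : tsupport (fun x => 1 - ω x) ⊆ Kᶜ)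
    {f : Lp ℂ p (volume : Measure (EuclideanSpace ℝ (Fin n)))}
    (hf : f ∈ spectralSubspace p q K) (v : Λ → ℂ) :
    (∃ g : EuclideanSpace ℝ (Fin n) → ℂ, Continuous g ∧ f =ᵐ[volume] g ∧ ∀ γ : Λ, g γ = v γ) ↔
      ∀ γ : Λ, pair p q f (translate q (γ : EuclideanSpace ℝ (Fin n))
        ((𝓕 ω : 𝓢(EuclideanSpace ℝ (Fin n), ℂ)).toLp q volume)) = v γ := by
  have h1 := ae_eq_pair_translate (q := q) hq hω hf
  have hc : Continuous fun x => pair p q f (translate q x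
      ((𝓕 ω : 𝓢(EuclideanSpace ℝ (Fin n), ℂ)).toLp q volume)) :=
    (pair p q f).continuous.comp (continuous_translate hq _)
  constructor
  · rintro ⟨g, hg, hfg, hgv⟩ γ
    rw [← hgv γ, (hg.ae_eq_iff_eq volume hc).1 (hfg.symm.trans h1)]
  · exact fun h => ⟨_, hc, h1, h⟩

/-- The spectral projection form exists when there is a complete interpolating sequence. -/
theorem exists_form_of_isCompleteInterpolating (hp1 : 1 < p) (hp : p ≠ ∞) (hq : q ≠ ∞)
    {K Λ : Set (EuclideanSpace ℝ (Fin n))} (hK : IsCompact K)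
    (hKp : 2 ≤ p ∨ 2 ≤ q ∧ volume (frontier K) = 0) (hΛ : IsCompleteInterpolating p K Λ) :
    ∃ B : Lp ℂ p (volume : Measure (EuclideanSpace ℝ (Fin n))) →L[ℂ]
      Lp ℂ q (volume : Measure (EuclideanSpace ℝ (Fin n))) →L[ℂ] ℂ,
      ∀ φ ψ : 𝓢(EuclideanSpace ℝ (Fin n), ℂ),
        B ((𝓕⁻ φ : 𝓢(EuclideanSpace ℝ (Fin n), ℂ)).toLp p volume)
          ((𝓕 ψ : 𝓢(EuclideanSpace ℝ (Fin n), ℂ)).toLp q volume) =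
            ∫ x in scaleEquiv n '' K, φ x * ψ x := by
  have hK' : IsCompact (scaleEquiv n '' K) := hK.image (scaleEquiv n).continuous
  obtain ⟨ω, hω⟩ := exists_schwartz_one_near hK'.isBounded
  obtain ⟨P, hP, hP'⟩ := exists_projection (q := q) hp1 hp hq
    (𝓕 ω : 𝓢(EuclideanSpace ℝ (Fin n), ℂ)) (K := scaleEquiv n '' K) (Λ := Λ) fun v => by
      refine (existsUnique_congr fun f => ?_).1 (hΛ v)
      rw [mem_bandlimited_iff (q := q)]
      exact and_congr_right fun hf => exists_continuous_iff_pair_translate hq hω hf _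
  obtain ⟨B, hB, hB1, hB2⟩ := exists_invariant_form hp hq P hP hP'
  refine ⟨B, ?_⟩
  rcases hKp with h2 | ⟨h2, hf⟩
  · exact form_eq_setIntegral_of_two_le_left h2 hp hq hK'.isClosed hB hB1 hB2
  · exact form_eq_setIntegral_of_two_le_right h2 hp hq hK'.isClosed
      (volume_frontier_image_scaleEquiv hf) hB hB1 hB2

theorem l2Fourier_spectralCut {K : Set (EuclideanSpace ℝ (Fin n))}
    (hK : MeasurableSet (scaleEquiv n '' K))
    (f : Lp ℂ 2 (volume : Measure (EuclideanSpace ℝ (Fin n)))) :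
    l2Fourier (spectralCut hK f) =ᵐ[volume]
      fun ξ => K.indicator (fun _ => (1 : ℂ)) ξ * l2Fourier f ξ := by
  have hqm : Measure.QuasiMeasurePreserving (scaleEquiv n) volume volume :=
    -- The dilation pulls null sets back to null sets, so the almost everywhere identity survives
    -- rescaling.
    Measure.LinearMap.quasiMeasurePreserving volume (scaleEquiv n).toLinearMap
      (scaleEquiv n).toLinearEquiv.isUnit_det'.ne_zero
  filter_upwards [hqm.ae (fourier_spectralCut hK f)] with ξ hξ
  refine hξ.trans ?_
  have hmem : scaleEquiv n ξ ∈ scaleEquiv n '' K ↔ ξ ∈ K :=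
    (scaleEquiv n).injective.mem_set_image
  by_cases h : ξ ∈ K
  · rw [Set.indicator_of_mem (hmem.2 h), Set.indicator_of_mem h, one_mul]
    rfl
  · rw [Set.indicator_of_notMem (fun h' => h (hmem.1 h')), Set.indicator_of_notMem h, zero_mul]

theorem isFourierMultiplier_indicator (hp1 : 1 < p) (hp : p ≠ ∞) (hq : q ≠ ∞)
    {K Λ : Set (EuclideanSpace ℝ (Fin n))} (hK : IsCompact K)
    (hKp : 2 ≤ p ∨ 2 ≤ q ∧ volume (frontier K) = 0) (hΛ : IsCompleteInterpolating p K Λ) :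
    IsFourierMultiplier p (K.indicator fun _ => (1 : ℂ)) := by
  obtain ⟨B, hB⟩ := exists_form_of_isCompleteInterpolating hp1 hp hq hK hKp hΛ
  have hKm : MeasurableSet (scaleEquiv n '' K) :=
    (hK.image (scaleEquiv n).continuous).isClosed.measurableSet
  obtain ⟨T, hT⟩ := exists_multiplier hp1 hp hq hKm hB
  refine ⟨T, fun f hfp hf2 => ?_⟩
  have hTf := hT f hfp hf2
  have hm : MemLp (T (hfp.toLp f)) 2 volume := (memLp_congr_ae hTf).2 (Lp.memLp _)
  refine ⟨hm, ?_⟩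
  have h : hm.toLp _ = spectralCut hKm (hf2.toLp f) := Lp.ext (hm.coeFn_toLp.trans hTf)
  rw [h]
  exact l2Fourier_spectralCut hKm _

end Bandlimited

end StableSampling
theorem mainTheorem2 (n : ℕ) (p : ℝ≥0∞) [Fact (1 ≤ p)] (hp1 : 1 < p) (hp : p < ∞)
    (K : Set (EuclideanSpace ℝ (Fin n))) (hK : IsCompact K)
    (hKp : 2 ≤ p ∨ volume (frontier K) = 0)
    (Λ : Set (EuclideanSpace ℝ (Fin n)))
    (hΛ : StableSampling.IsCompleteInterpolating p K Λ) :
    StableSampling.IsFourierMultiplier p (K.indicator fun _ => (1 : ℂ)) := by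
  have hpq : ENNReal.HolderConjugate p (1 - p⁻¹)⁻¹ := ENNReal.HolderConjugate.inv_one_sub_inv' hp1.le
  have hq1 : Fact (1 ≤ (1 - p⁻¹)⁻¹) := by simp [fact_iff]
  have hq : (1 - p⁻¹)⁻¹ ≠ ∞ := by
    rw [ENNReal.inv_ne_top]
    exact (tsub_pos_of_lt (ENNReal.inv_lt_one.2 hp1)).ne'
  refine StableSampling.isFourierMultiplier_indicator (q := (1 - p⁻¹)⁻¹) hp1 hp.ne hq hK ?_ hΛ
  rcases le_total 2 p with h2 | h2
  · exact Or.inl h2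
  · refine hKp.imp_right fun hf => ⟨?_, hf⟩
    -- For `p ≤ 2` the conjugate exponent is at least `2`, since `1 - 1/p ≤ 1/2`.
    rw [ENNReal.le_inv_iff_le_inv, tsub_le_iff_left, ← ENNReal.inv_two_add_inv_two]
    exact add_le_add_left (ENNReal.inv_le_inv.2 h2) _
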